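/- Let $m\ge 1/2$ and $a>0$ be real numbers, and let $\mathbb{R}_-=(-\infty,0]$. Consider the singular boundary value problem on $\mathbb{R}_-$ \[ (\Phi''+\Phi\Phi')'=\frac{2m-1}{m}\,(\Phi')^2,\qquad -\infty<\tau\le 0, \] \[ \lim_{\tau\to-\infty}e^{-\varepsilon\tau}\bigl(\Phi(\tau)+a\bigr)=\lim_{\tau\to-\infty}e^{-\varepsilon\tau}\Phi'(\tau)=\lim_{\tau\to-\infty}e^{-\varepsilon\tau}\Phi''(\tau)=0\quad\text{for all }0<\varepsilon<a,\qquad \Phi(0)=0, \] where solutions are three times continuously differentiable on $\mathbb{R}_-$ (one-sided derivatives at $0$). Then this problem has a unique solution $\Phi_m(\cdot,a)$ on $\mathbb{R}_-$. The solution $\Phi=\Phi_m(\cdot,a)$ is convex and strictly increasing on $\mathbb{R}_-$. It belongs to the family of exponential Lyapunov series: there are $d=d(m,a)>0$ and $\tilde\tau\le 0$ such that \[ \Phi(\tau)=-a+d\,e^{a\tau}+\sum_{l=2}^{\infty}h_l\,d^{\,l}e^{la\tau}\qquad(\tau\le\tilde\tau), \] with a convergent series, where $h_1=1$ and \[ h_l=\frac{1}{a\,l^2(l-1)}\sum_{k=1}^{l-1}k\Bigl(\frac{(m-1)(l-k)}{m}-k\Bigr)h_kh_{l-k},\qquad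 l\ge 2. \] For every $\tau\le 0$ it satisfies, with convergent integrals, \[ \Phi''(\tau)+\Phi(\tau)\Phi'(\tau)=\frac{2m-1}{m}\int_{-\infty}^{\tau}\Phi'(t)^2\,dt, \] \[ \Phi'(\tau)=\frac{a^2-\Phi(\tau)^2}{2}+\frac{2m-1}{m}\int_{-\infty}^{\tau}(\tau-s)\,\Phi'(s)^2\,ds, \] and in particular \[ \Phi''(0)=\frac{2m-1}{m}\int_{-\infty}^{0}\Phi'(t)^2\,dt,\qquad \Phi'(0)=\frac{a^2}{2}-\frac{2m-1}{m}\int_{-\infty}^{0}s\,\Phi'(s)^2\,ds. \] Moreover, for every $\tau\le 0$, \[ a\bigl(e^{a\tau}-1\bigr)\le\Phi_m(\tau,a)\le a\tanh(a\tau/2). \] -/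

import Mathlib

open Set Filter Topology MeasureTheory

noncomputable section

namespace MixingLayer

/-- The derivative of a function on the closed half-line `(-∞, 0]`
(the ordinary derivative at `τ < 0`, the left derivative at `τ = 0`). -/
def D (f : ℝ → ℝ) : ℝ → ℝ := fun τ => derivWithin f (Iic 0) τ

/-- `Φ` is a classical solution on `(-∞, 0]` of the singular boundary value problem
`(Φ'' + Φ Φ')' = ((2m-1)/m) Φ'^2`, with `exp(-ετ) (Φ + a, Φ', Φ'') → (0, 0, 0)` as `τ → -∞` for every
`0 < ε < a`, and `Φ(0) = 0`. Values of `Φ` on `(0, ∞)` play no role. -/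
structure IsBVPSolution (m a : ℝ) (Φ : ℝ → ℝ) : Prop where
  smooth : ContDiffOn ℝ 3 Φ (Iic 0)
  ode : ∀ τ ≤ 0, D (fun t => D (D Φ) t + Φ t * D Φ t) τ = ((2 * m - 1) / m) * (D Φ τ) ^ 2
  lim_zero : ∀ ε : ℝ, 0 < ε → ε < a →
    Tendsto (fun τ => Real.exp (-ε * τ) * (Φ τ + a)) atBot (𝓝 0)
  lim_one : ∀ ε : ℝ, 0 < ε → ε < a →
    Tendsto (fun τ => Real.exp (-ε * τ) * D Φ τ) atBot (𝓝 0)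
  lim_two : ∀ ε : ℝ, 0 < ε → ε < a →
    Tendsto (fun τ => Real.exp (-ε * τ) * D (D Φ) τ) atBot (𝓝 0)
  at_zero : Φ 0 = 0

/-- The coefficients `h_l` of the exponential Lyapunov series: `h_1 = 1` and, for `l ≥ 2`,
`h_l = (∑_{k=1}^{l-1} k ((m-1)(l-k)/m - k) h_k h_{l-k}) / (a l^2 (l-1))`; see `lyapunovCoeff_rec`.
(`h_0` is not used.) -/
def lyapunovCoeff (m a : ℝ) : ℕ → ℝ
  | 0 => 0
  | 1 => 1
  | n + 2 =>
    (∑ k : Fin (n + 1),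
      ((k : ℝ) + 1) * ((m - 1) * (((n : ℝ) + 2) - ((k : ℝ) + 1)) / m - ((k : ℝ) + 1))
        * lyapunovCoeff m a (k.val + 1) * lyapunovCoeff m a (n + 1 - k.val))
      / (a * ((n : ℝ) + 2) ^ 2 * ((n : ℝ) + 1))
  termination_by l => l
  decreasing_by all_goals omega

theorem lyapunovCoeff_one (m a : ℝ) : lyapunovCoeff m a 1 = 1 := by
  rw [lyapunovCoeff]

theorem lyapunovCoeff_rec (m a : ℝ) (l : ℕ) (hl : 2 ≤ l) :
    lyapunovCoeff m a l =
      (∑ k ∈ Finset.Icc 1 (l - 1),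
        (k : ℝ) * ((m - 1) * ((l : ℝ) - (k : ℝ)) / m - (k : ℝ))
          * lyapunovCoeff m a k * lyapunovCoeff m a (l - k))
        / (a * (l : ℝ) ^ 2 * ((l : ℝ) - 1)) := by
  obtain ⟨n, rfl⟩ := Nat.exists_eq_add_of_le' hl
  have hI : Finset.Icc 1 (n + 2 - 1) = Finset.Ico 1 (n + 2) := by
    ext x; simp only [Finset.mem_Icc, Finset.mem_Ico]; omega
  rw [lyapunovCoeff, hI, Finset.sum_Ico_eq_sum_range, show n + 2 - 1 = n + 1 from rfl,
    Finset.sum_range]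
  congr 1
  · refine Finset.sum_congr rfl fun k _ => ?_
    rw [show n + 2 - (1 + k.val) = n + 1 - k.val by omega, Nat.add_comm 1 k.val]
    push_cast
    ring
  · push_cast
    ring

/-- `Φ` belongs to the Lyapunov family with parameter `d`: for all `τ ≤ τ₀`, for some `τ₀ ≤ 0`,
the series converges and `Φ(τ) = -a + d exp(aτ) + ∑_{l ≥ 2} h_l d^l exp(l a τ)`. -/
def IsLyapunovSeries (m a d : ℝ) (Φ : ℝ → ℝ) : Prop :=
  ∃ τ₀ : ℝ, τ₀ ≤ 0 ∧ ∀ τ ≤ τ₀,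
    HasSum (fun n : ℕ => lyapunovCoeff m a (n + 2) * d ^ (n + 2)
        * Real.exp (((n : ℝ) + 2) * a * τ))
      (Φ τ - (-a + d * Real.exp (a * τ)))

end MixingLayer

end

/-! Put c = (2m-1)/m and (f, g, h) = (Φ, Φ', Φ''). The equation is the autonomous system f' = g, g'
= h, h' = -f h + (c-1) g², and m ≥ 1/2 gives 0 ≤ c ≤ 2.

Near -∞ the flux h + f g = c ∫ g² is quadratically small, so h - a g is too, and exp(-aτ) g(τ) has a
limit b. The number b determines the flow: two flows with the same b agree near -∞ by a contraction
estimate, and then everywhere by ODE uniqueness (`eqOn_of_scaled`). A translation in τ by s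
multiplies b by exp(a s), so only the sign of b matters up to translation.

If b > 0, then g' ≥ -f g forces g > 0, and h ≥ 0 as long as f ≤ 0. The quantity W = g h' - h²
satisfies W' = -f W - (2-c) g² h, hence W ≤ 0 there. So h/g decreases from its limit a, giving h ≤ a
g and g ≤ a (f + a). If b = 0, then f is constantly -a. If b < 0, the same W has the opposite sign,
h stays negative and f ≤ -a. A flow vanishing at 0 therefore has b > 0; two such flows are
translates of each other, and by strict monotonicity the translation is trivial.

For existence, the Lyapunov series solves the system near -∞ with b > 0. The bounds above keep it in
a box while f ≤ 0, and convexity makes f reach 0 in finite time (`exists_continuation`). Translating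
that time to 0 gives the solution. The integral relations come from integrating the flux; the upper
estimate is comparison with f' = (a² - f²)/2, whose solution vanishing at 0 is a tanh(aτ/2), and the
lower one is comparison with f' = a (f + a). -/

noncomputable section

namespace MixingLayer

/-! ### Calculus on closed half-lines. -/

/-- `x` has derivative `x'` on the closed half-line `(-∞, T]`, one-sided at `T`. -/
def HasDerivIic (T : ℝ) (x x' : ℝ → ℝ) : Prop :=
  ∀ τ ≤ T, HasDerivWithinAt x (x' τ) (Iic T) τ

namespace HasDerivIic

variable {T S : ℝ} {x x' y y' : ℝ → ℝ}

theorem continuousOn (hx : HasDerivIic T x x') : ContinuousOn x (Iic T) :=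
  fun τ hτ => (hx τ hτ).continuousWithinAt

theorem hasDerivAt (hx : HasDerivIic T x x') {τ : ℝ} (hτ : τ < T) : HasDerivAt x (x' τ) τ :=
  (hx τ hτ.le).hasDerivAt (Iic_mem_nhds hτ)

theorem mono (hx : HasDerivIic T x x') (hS : S ≤ T) : HasDerivIic S x x' :=
  fun τ hτ => (hx τ (hτ.trans hS)).mono (Iic_subset_Iic.2 hS)

theorem comp_add (hx : HasDerivIic T x x') (s : ℝ) :
    HasDerivIic (T - s) (fun τ => x (τ + s)) (fun τ => x' (τ + s)) := by
  intro τ hτ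
  have h := (hx (τ + s) (by linarith)).comp τ
    (((hasDerivAt_id τ).add_const s).hasDerivWithinAt (s := Iic (T - s)))
    (fun u hu => by simp only [mem_Iic, id] at *; linarith)
  rw [mul_one] at h
  exact h

theorem monotoneOn (hx : HasDerivIic T x x') (h : ∀ τ < T, 0 ≤ x' τ) : MonotoneOn x (Iic T) := by
  refine monotoneOn_of_hasDerivWithinAt_nonneg (f' := x') (convex_Iic T) hx.continuousOn
    (fun τ hτ => ?_) (fun τ hτ => ?_)
  · rw [interior_Iic] at hτ ⊢
    exact (hx.hasDerivAt hτ).hasDerivWithinAt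
  · rw [interior_Iic] at hτ
    exact h τ hτ

theorem antitoneOn (hx : HasDerivIic T x x') (h : ∀ τ < T, x' τ ≤ 0) : AntitoneOn x (Iic T) := by
  have hn : HasDerivIic T (fun τ => - x τ) (fun τ => - x' τ) := fun τ hτ => (hx τ hτ).neg
  have := hn.monotoneOn (fun τ hτ => by have := h τ hτ; linarith)
  intro u hu v hv huv
  have := this hu hv huv
  simp only at this
  linarith

theorem strictMonoOn (hx : HasDerivIic T x x') (h : ∀ τ < T, 0 < x' τ) :
    StrictMonoOn x (Iic T) := by
  refine strictMonoOn_of_deriv_pos (convex_Iic T) hx.continuousOn fun τ hτ => ?_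
  rw [interior_Iic] at hτ
  rw [(hx.hasDerivAt hτ).deriv]
  exact h τ hτ

end HasDerivIic

/-! ### Limits and exponential estimates at -∞. -/

section Limits

variable {T L : ℝ} {x x' : ℝ → ℝ}

theorem le_of_monotoneOn_of_tendsto (hx : MonotoneOn x (Iic T)) (hL : Tendsto x atBot (𝓝 L))
    {τ : ℝ} (hτ : τ ≤ T) : L ≤ x τ := by
  refine le_of_tendsto hL ?_
  filter_upwards [eventually_le_atBot τ] with s hs
  exact hx (hs.trans hτ) hτ hs

theorem HasDerivIic.nonneg_of_tendsto_zero (hx : HasDerivIic T x x') (h : ∀ τ < T, 0 ≤ x' τ)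
    (hL : Tendsto x atBot (𝓝 0)) {τ : ℝ} (hτ : τ ≤ T) : 0 ≤ x τ :=
  le_of_monotoneOn_of_tendsto (hx.monotoneOn h) hL hτ

theorem exists_exp_bound {ε : ℝ} (hx : ContinuousOn x (Iic T))
    (hL : Tendsto (fun τ => Real.exp (-ε * τ) * x τ) atBot (𝓝 L)) :
    ∃ C > 0, ∀ τ ≤ T, |x τ| ≤ C * Real.exp (ε * τ) := by
  have hev : ∀ᶠ τ in atBot, |Real.exp (-ε * τ) * x τ| ≤ |L| + 1 :=
    hL.abs.eventually (eventually_le_nhds (by linarith))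
  obtain ⟨S, hS⟩ := eventually_atBot.1 hev
  have hcont : ContinuousOn (fun τ => Real.exp (-ε * τ) * x τ) (Icc S T) :=
    (by fun_prop : Continuous fun τ : ℝ => Real.exp (-ε * τ)).continuousOn.mul
      (hx.mono Icc_subset_Iic_self)
  obtain ⟨B, hB⟩ := isCompact_Icc.exists_bound_of_continuousOn hcont
  refine ⟨max (|L| + 1) B, lt_max_of_lt_left (by positivity), fun τ hτ => ?_⟩
  have key : |Real.exp (-ε * τ) * x τ| ≤ max (|L| + 1) B := by
    rcases le_total τ S with h | h
    · exact (hS τ h).trans (le_max_left _ _)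
    · exact (hB τ ⟨h, hτ⟩).trans (le_max_right _ _)
  rw [abs_mul, Real.abs_exp] at key
  calc |x τ| = Real.exp (-ε * τ) * |x τ| * Real.exp (ε * τ) := by
        rw [mul_right_comm, ← Real.exp_add]; simp
    _ ≤ _ := by gcongr

theorem tendsto_exp_mul_atBot {r : ℝ} (hr : 0 < r) :
    Tendsto (fun τ => Real.exp (r * τ)) atBot (𝓝 0) :=
  Real.tendsto_exp_atBot.comp (tendsto_id.const_mul_atBot hr)

theorem tendsto_zero_of_exp_bound {C r ε : ℝ} (hr : ε < r)
    (hx : ∀ τ ≤ T, |x τ| ≤ C * Real.exp (r * τ)) :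
    Tendsto (fun τ => Real.exp (-ε * τ) * x τ) atBot (𝓝 0) := by
  have h0 : Tendsto (fun τ => C * Real.exp ((r - ε) * τ)) atBot (𝓝 0) := by
    simpa using (tendsto_exp_mul_atBot (sub_pos.2 hr)).const_mul C
  refine squeeze_zero_norm' ?_ h0
  filter_upwards [eventually_le_atBot T] with τ hτ
  rw [Real.norm_eq_abs, abs_mul, Real.abs_exp]
  calc Real.exp (-ε * τ) * |x τ| ≤ Real.exp (-ε * τ) * (C * Real.exp (r * τ)) := by
        gcongr; exact hx τ hτ
    _ = C * Real.exp ((r - ε) * τ) := by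
        rw [mul_left_comm, ← Real.exp_add]; ring_nf

theorem tendsto_zero_of_exp_bound' {C r : ℝ} (hr : 0 < r)
    (hx : ∀ τ ≤ T, |x τ| ≤ C * Real.exp (r * τ)) : Tendsto x atBot (𝓝 0) := by
  simpa using tendsto_zero_of_exp_bound hr hx

theorem hasDerivAt_exp_mul (r τ : ℝ) :
    HasDerivAt (fun τ => Real.exp (r * τ)) (r * Real.exp (r * τ)) τ := by
  simpa [mul_comm] using ((hasDerivAt_id τ).const_mul r).exp

/-- Integrating an exponential bound of the derivative from `-∞`. -/
theorem HasDerivIic.exp_bound {C r : ℝ} (hr : 0 < r) (hx : HasDerivIic T x x')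
    (hb : ∀ τ ≤ T, |x' τ| ≤ C * Real.exp (r * τ)) (hL : Tendsto x atBot (𝓝 L)) {τ : ℝ}
    (hτ : τ ≤ T) : |x τ - L| ≤ C / r * Real.exp (r * τ) := by
  have hE : Tendsto (fun τ => C / r * Real.exp (r * τ)) atBot (𝓝 0) := by
    simpa using (tendsto_exp_mul_atBot hr).const_mul (C / r)
  have hd : ∀ τ, HasDerivAt (fun τ => C / r * Real.exp (r * τ)) (C * Real.exp (r * τ)) τ := by
    intro τ
    refine ((hasDerivAt_exp_mul r τ).const_mul (C / r)).congr_deriv ?_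
    rw [← mul_assoc, div_mul_cancel₀ _ hr.ne']
  have hL0 : Tendsto (fun τ => x τ - L) atBot (𝓝 0) := by simpa using hL.sub_const L
  have h1 : HasDerivIic T (fun τ => C / r * Real.exp (r * τ) - (x τ - L))
      (fun τ => C * Real.exp (r * τ) - x' τ) :=
    fun τ hτ => (hd τ).hasDerivWithinAt.sub ((hx τ hτ).sub_const L)
  have h2 : HasDerivIic T (fun τ => C / r * Real.exp (r * τ) + (x τ - L))
      (fun τ => C * Real.exp (r * τ) + x' τ) :=
    fun τ hτ => (hd τ).hasDerivWithinAt.add ((hx τ hτ).sub_const L)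
  -- Both (C/r) exp(rτ) ∓ (x - L) are nondecreasing with limit 0 at -∞, hence nonnegative.
  have e1 := h1.nonneg_of_tendsto_zero (fun τ hτ => by have := abs_le.1 (hb τ hτ.le); linarith)
    (by simpa using hE.sub hL0) hτ
  have e2 := h2.nonneg_of_tendsto_zero (fun τ hτ => by have := abs_le.1 (hb τ hτ.le); linarith)
    (by simpa using hE.add hL0) hτ
  rw [abs_le]
  constructor <;> linarith

/-- A function with an exponentially bounded derivative has a limit at `-∞`. -/
theorem HasDerivIic.exists_tendsto {C r : ℝ} (hr : 0 < r) (hx : HasDerivIic T x x')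
    (hb : ∀ τ ≤ T, |x' τ| ≤ C * Real.exp (r * τ)) : ∃ L, Tendsto x atBot (𝓝 L) := by
  have hE : Tendsto (fun τ => C / r * Real.exp (r * τ)) atBot (𝓝 0) := by
    simpa using (tendsto_exp_mul_atBot hr).const_mul (C / r)
  have hd : ∀ τ, HasDerivAt (fun τ => C / r * Real.exp (r * τ)) (C * Real.exp (r * τ)) τ := by
    intro τ
    refine ((hasDerivAt_exp_mul r τ).const_mul (C / r)).congr_deriv ?_
    rw [← mul_assoc, div_mul_cancel₀ _ hr.ne']
  have hC : 0 ≤ C := by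
    have := (abs_nonneg _).trans (hb T le_rfl)
    exact nonneg_of_mul_nonneg_left this (Real.exp_pos _)
  have h1 : HasDerivIic T (fun τ => C / r * Real.exp (r * τ) - x τ)
      (fun τ => C * Real.exp (r * τ) - x' τ) :=
    fun τ hτ => (hd τ).hasDerivWithinAt.sub (hx τ hτ)
  have h2 : HasDerivIic T (fun τ => C / r * Real.exp (r * τ) + x τ)
      (fun τ => C * Real.exp (r * τ) + x' τ) :=
    fun τ hτ => (hd τ).hasDerivWithinAt.add (hx τ hτ)
  have m1 := h1.monotoneOn (fun τ hτ => by have := abs_le.1 (hb τ hτ.le); linarith)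
  have m2 := h2.monotoneOn (fun τ hτ => by have := abs_le.1 (hb τ hτ.le); linarith)
  -- Freezing the argument at T makes the sum monotone on all of ℝ, so it converges to its infimum
  -- at -∞.
  let y : ℝ → ℝ := fun τ => C / r * Real.exp (r * min τ T) + x (min τ T)
  have my : Monotone y := fun u v huv =>
    m2 (min_le_right u T) (min_le_right v T) (min_le_min_right T huv)
  have hbdd : BddBelow (range y) := by
    refine ⟨-(C / r * Real.exp (r * T) - x T), ?_⟩
    rintro _ ⟨τ, rfl⟩
    have := m1 (min_le_right τ T) (self_mem_Iic) (min_le_right τ T)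
    have h3 : 0 ≤ C / r * Real.exp (r * min τ T) := by positivity
    simp only [y] at this ⊢
    linarith
  refine ⟨_, ((tendsto_atBot_ciInf my hbdd).sub hE).congr' ?_⟩
  filter_upwards [eventually_le_atBot T] with τ hτ
  simp [y, min_eq_left hτ]

theorem integrableOn_Iic_of_exp_bound {C r : ℝ} (hr : 0 < r) (hx : ContinuousOn x (Iic T))
    (hb : ∀ τ ≤ T, |x τ| ≤ C * Real.exp (r * τ)) : IntegrableOn x (Iic T) := by
  refine Integrable.mono' ((integrableOn_exp_mul_Iic hr T).const_mul C)
    (hx.aestronglyMeasurable measurableSet_Iic) ?_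
  rw [ae_restrict_iff' measurableSet_Iic]
  exact Eventually.of_forall fun τ hτ => hb τ hτ

theorem exists_antiderivative {C r : ℝ} (hr : 0 < r) (hx : ContinuousOn x (Iic T))
    (hb : ∀ τ ≤ T, |x τ| ≤ C * Real.exp (r * τ)) :
    ∃ A : ℝ → ℝ, HasDerivIic T A x ∧ ∃ B, ∀ τ ≤ T, |A τ| ≤ B := by
  have hc : Continuous fun τ => x (min τ T) :=
    hx.comp_continuous (by fun_prop) fun τ => min_le_right τ T
  have hd : HasDerivIic T (fun τ => ∫ s in T..τ, x (min s T)) x := by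
    intro τ hτ
    have := (hc.integral_hasStrictDerivAt T τ).hasDerivAt.hasDerivWithinAt (s := Iic T)
    simpa [min_eq_left hτ] using this
  obtain ⟨L, hL⟩ := hd.exists_tendsto hr hb
  have hC : 0 ≤ C := by
    have := (abs_nonneg _).trans (hb T le_rfl)
    exact nonneg_of_mul_nonneg_left this (Real.exp_pos _)
  refine ⟨_, hd, |L| + C / r * Real.exp (r * T), fun τ hτ => ?_⟩
  have h1 := hd.exp_bound hr hb hL hτ
  have h2 : C / r * Real.exp (r * τ) ≤ C / r * Real.exp (r * T) := by gcongr
  have h3 := abs_sub_abs_le_abs_sub (∫ s in T..τ, x (min s T)) L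
  linarith

/-- Comparison for `x' ≥ α x`, where `α → a` exponentially fast at `-∞`. -/
theorem HasDerivIic.comparison {α : ℝ → ℝ} {C r a : ℝ} (hr : 0 < r) (hx : HasDerivIic T x x')
    (hα : ContinuousOn α (Iic T)) (hb : ∀ τ ≤ T, |α τ - a| ≤ C * Real.exp (r * τ))
    (hle : ∀ τ < T, α τ * x τ ≤ x' τ)
    (hL : Tendsto (fun τ => Real.exp (-a * τ) * x τ) atBot (𝓝 L)) :
    (0 ≤ L → ∀ τ ≤ T, 0 ≤ x τ) ∧ (0 < L → ∀ τ ≤ T, 0 < x τ) := by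
  obtain ⟨A, hA, B, hB⟩ := exists_antiderivative (x := fun τ => α τ - a) hr
    (hα.sub continuousOn_const) hb
  -- Integrating factor for x' ≥ α x. The rate a is split off, so the remaining exponent A is
  -- bounded and X inherits the sign of L at -∞.
  let X : ℝ → ℝ := fun τ => Real.exp (-A τ) * (Real.exp (-a * τ) * x τ)
  have hX : HasDerivIic T X
      (fun τ => Real.exp (-A τ) * Real.exp (-a * τ) * (x' τ - α τ * x τ)) := by
    intro τ hτ
    have := (hA τ hτ).neg.exp.mul ((hasDerivAt_exp_mul (-a) τ).hasDerivWithinAt.mul (hx τ hτ))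
    refine this.congr_deriv ?_
    simp only [Pi.mul_apply, Pi.neg_apply]
    ring
  have hmono := hX.monotoneOn fun τ hτ =>
    mul_nonneg (by positivity) (sub_nonneg.2 (hle τ hτ))
  have hpos : ∀ τ, 0 < X τ → 0 < x τ := fun τ h =>
    pos_of_mul_pos_right (pos_of_mul_pos_right h (Real.exp_pos _).le) (Real.exp_pos _).le
  have hstrict : 0 < L → ∀ τ ≤ T, 0 < x τ := by
    intro hLpos τ hτ
    obtain ⟨s, hs, hsτ⟩ := ((hL.eventually (lt_mem_nhds hLpos)).and
      (eventually_le_atBot τ)).exists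
    have h1 : 0 < X s := mul_pos (Real.exp_pos _) hs
    exact hpos τ (h1.trans_le (hmono (hsτ.trans hτ) hτ hsτ))
  refine ⟨fun hL0 τ hτ => ?_, hstrict⟩
  rcases hL0.eq_or_lt with rfl | hLpos
  · have hlim : Tendsto X atBot (𝓝 0) := by
      have h0 : Tendsto (fun τ => Real.exp B * |Real.exp (-a * τ) * x τ|) atBot (𝓝 0) := by
        simpa using hL.abs.const_mul (Real.exp B)
      refine squeeze_zero_norm' ?_ h0
      filter_upwards [eventually_le_atBot T] with s hs
      rw [Real.norm_eq_abs, abs_mul, Real.abs_exp]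
      gcongr
      have := abs_le.1 (hB s hs)
      linarith
    have := le_of_monotoneOn_of_tendsto hmono hlim hτ
    exact nonneg_of_mul_nonneg_right (nonneg_of_mul_nonneg_right this (Real.exp_pos _))
      (Real.exp_pos _)
  · exact (hstrict hLpos τ hτ).le

end Limits

/-! ### Decaying flows: asymptotics at -∞ and integral relations. -/

/-- The triple `(f, f', f'')` of a solution of `f''' + f f'' = (c - 1) f'^2` on `(-∞, T]` that tends
to `(-a, 0, 0)` at `-∞` faster than `exp (ε τ)`, for every `ε < a`. -/
structure IsDecayingFlow (c a T : ℝ) (f g h : ℝ → ℝ) : Prop where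
  deriv_f : HasDerivIic T f g
  deriv_g : HasDerivIic T g h
  deriv_h : HasDerivIic T h (fun τ => -f τ * h τ + (c - 1) * g τ ^ 2)
  lim_f : ∀ ε : ℝ, 0 < ε → ε < a →
    Tendsto (fun τ => Real.exp (-ε * τ) * (f τ + a)) atBot (𝓝 0)
  lim_g : ∀ ε : ℝ, 0 < ε → ε < a → Tendsto (fun τ => Real.exp (-ε * τ) * g τ) atBot (𝓝 0)
  lim_h : ∀ ε : ℝ, 0 < ε → ε < a → Tendsto (fun τ => Real.exp (-ε * τ) * h τ) atBot (𝓝 0)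

theorem tendsto_exp_mul_comp_add {x : ℝ → ℝ} {ε L : ℝ}
    (hx : Tendsto (fun τ => Real.exp (-ε * τ) * x τ) atBot (𝓝 L)) (s : ℝ) :
    Tendsto (fun τ => Real.exp (-ε * τ) * x (τ + s)) atBot (𝓝 (Real.exp (ε * s) * L)) := by
  have := (hx.comp (tendsto_atBot_add_const_right atBot s tendsto_id)).const_mul
    (Real.exp (ε * s))
  refine this.congr fun τ => ?_
  simp only [Function.comp_apply, id]
  rw [← mul_assoc, ← Real.exp_add]
  ring_nf

namespace IsDecayingFlow

variable {c a T S b : ℝ} {f g h : ℝ → ℝ}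

theorem mono (F : IsDecayingFlow c a T f g h) (hS : S ≤ T) : IsDecayingFlow c a S f g h :=
  ⟨F.deriv_f.mono hS, F.deriv_g.mono hS, F.deriv_h.mono hS, F.lim_f, F.lim_g, F.lim_h⟩

theorem comp_add (F : IsDecayingFlow c a T f g h) (s : ℝ) :
    IsDecayingFlow c a (T - s) (fun τ => f (τ + s)) (fun τ => g (τ + s)) (fun τ => h (τ + s)) where
  deriv_f := F.deriv_f.comp_add s
  deriv_g := F.deriv_g.comp_add s
  deriv_h := F.deriv_h.comp_add s
  lim_f ε h1 h2 := by
    simpa using tendsto_exp_mul_comp_add (x := fun τ => f τ + a) (F.lim_f ε h1 h2) s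
  lim_g ε h1 h2 := by simpa using tendsto_exp_mul_comp_add (F.lim_g ε h1 h2) s
  lim_h ε h1 h2 := by simpa using tendsto_exp_mul_comp_add (F.lim_h ε h1 h2) s

theorem bound (F : IsDecayingFlow c a T f g h) {ε : ℝ} (h0 : 0 < ε) (h1 : ε < a) :
    ∃ C > 0, ∀ τ ≤ T, |f τ + a| ≤ C * Real.exp (ε * τ) ∧ |g τ| ≤ C * Real.exp (ε * τ) := by
  obtain ⟨C₁, hC₁, H₁⟩ := exists_exp_bound (x := fun τ => f τ + a) (T := T)
    (F.deriv_f.continuousOn.add continuousOn_const) (F.lim_f ε h0 h1)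
  obtain ⟨C₂, hC₂, H₂⟩ := exists_exp_bound F.deriv_g.continuousOn (F.lim_g ε h0 h1)
  refine ⟨max C₁ C₂, lt_max_of_lt_left hC₁, fun τ hτ => ⟨(H₁ τ hτ).trans ?_, (H₂ τ hτ).trans ?_⟩⟩
  · gcongr; exact le_max_left _ _
  · gcongr; exact le_max_right _ _

theorem tendsto_zero_of_lim (ha : 0 < a) {x : ℝ → ℝ}
    (hx : ∀ ε : ℝ, 0 < ε → ε < a → Tendsto (fun τ => Real.exp (-ε * τ) * x τ) atBot (𝓝 0)) :
    Tendsto x atBot (𝓝 0) := by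
  have := (tendsto_exp_mul_atBot (half_pos ha)).mul (hx (a / 2) (half_pos ha) (half_lt_self ha))
  rw [mul_zero] at this
  refine this.congr fun τ => ?_
  rw [← mul_assoc, ← Real.exp_add]
  simp

theorem tendsto_f (F : IsDecayingFlow c a T f g h) (ha : 0 < a) :
    Tendsto (fun τ => f τ + a) atBot (𝓝 0) := tendsto_zero_of_lim ha F.lim_f

theorem tendsto_g (F : IsDecayingFlow c a T f g h) (ha : 0 < a) : Tendsto g atBot (𝓝 0) :=
  tendsto_zero_of_lim ha F.lim_g

theorem tendsto_h (F : IsDecayingFlow c a T f g h) (ha : 0 < a) : Tendsto h atBot (𝓝 0) :=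
  tendsto_zero_of_lim ha F.lim_h

theorem tendsto_f' (F : IsDecayingFlow c a T f g h) (ha : 0 < a) : Tendsto f atBot (𝓝 (-a)) := by
  simpa using (F.tendsto_f ha).sub_const a

theorem deriv_flux (F : IsDecayingFlow c a T f g h) :
    HasDerivIic T (fun τ => h τ + f τ * g τ) (fun τ => c * g τ ^ 2) := by
  intro τ hτ
  refine ((F.deriv_h τ hτ).add ((F.deriv_f τ hτ).mul (F.deriv_g τ hτ))).congr_deriv ?_
  ring

theorem tendsto_flux (F : IsDecayingFlow c a T f g h) (ha : 0 < a) :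
    Tendsto (fun τ => h τ + f τ * g τ) atBot (𝓝 0) := by
  simpa using (F.tendsto_h ha).add ((F.tendsto_f' ha).mul (F.tendsto_g ha))

/-- The rate 2a/3 is admissible for g, being below a, while its double 4a/3 exceeds a. Quadratic
terms are thus negligible against exp(aτ). -/
theorem sq_bound (F : IsDecayingFlow c a T f g h) (ha : 0 < a) :
    ∃ C > 0, ∀ τ ≤ T, |g τ ^ 2| ≤ C * Real.exp (4 * a / 3 * τ) := by
  obtain ⟨C, hC, H⟩ := F.bound (ε := 2 * a / 3) (by positivity) (by linarith)
  refine ⟨C ^ 2, by positivity, fun τ hτ => ?_⟩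
  rw [abs_pow]
  calc |g τ| ^ 2 ≤ (C * Real.exp (2 * a / 3 * τ)) ^ 2 := by gcongr; exact (H τ hτ).2
    _ = _ := by
      rw [mul_pow, ← Real.exp_nat_mul]
      congr 2
      push_cast
      ring

theorem flux_bound (F : IsDecayingFlow c a T f g h) (ha : 0 < a) :
    ∃ C, ∀ τ ≤ T, |h τ + f τ * g τ| ≤ C * Real.exp (4 * a / 3 * τ) := by
  obtain ⟨C, hC, H⟩ := F.sq_bound ha
  refine ⟨|c| * C / (4 * a / 3), fun τ hτ => ?_⟩
  have := F.deriv_flux.exp_bound (r := 4 * a / 3) (C := |c| * C) (by positivity)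
    (fun τ hτ => ?_) (F.tendsto_flux ha) hτ
  · simpa using this
  · rw [abs_mul, mul_assoc]
    gcongr
    exact H τ hτ

/-- The difference h - a g equals the flux minus (f + a) g, and both are quadratically small. -/
theorem linear_bound (F : IsDecayingFlow c a T f g h) (ha : 0 < a) :
    ∃ C, ∀ τ ≤ T, |h τ - a * g τ| ≤ C * Real.exp (4 * a / 3 * τ) := by
  obtain ⟨C, hC⟩ := F.flux_bound ha
  obtain ⟨B, hB, H⟩ := F.bound (ε := 2 * a / 3) (by positivity) (by linarith)
  refine ⟨C + B * B, fun τ hτ => ?_⟩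
  have h1 : h τ - a * g τ = (h τ + f τ * g τ) - (f τ + a) * g τ := by ring
  have h2 : |(f τ + a) * g τ| ≤ B * B * Real.exp (4 * a / 3 * τ) := by
    rw [abs_mul]
    calc _ ≤ (B * Real.exp (2 * a / 3 * τ)) * (B * Real.exp (2 * a / 3 * τ)) := by
          gcongr
          exacts [(H τ hτ).1, (H τ hτ).2]
      _ = _ := by
          rw [mul_mul_mul_comm, ← Real.exp_add]
          congr 2
          ring
  rw [h1]
  exact (abs_sub _ _).trans ((add_le_add (hC τ hτ) h2).trans_eq (add_mul _ _ _).symm)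

theorem deriv_scaled (F : IsDecayingFlow c a T f g h) :
    HasDerivIic T (fun τ => Real.exp (-a * τ) * g τ)
      (fun τ => Real.exp (-a * τ) * (h τ - a * g τ)) := by
  intro τ hτ
  refine ((hasDerivAt_exp_mul (-a) τ).hasDerivWithinAt.mul (F.deriv_g τ hτ)).congr_deriv ?_
  ring

/-- The derivative of exp(-aτ) g is exp(-aτ)(h - a g), of size exp(aτ/3). The limit b parametrizes
the flows that leave -a. -/
theorem exists_tendsto_scaled (F : IsDecayingFlow c a T f g h) (ha : 0 < a) :
    ∃ b, Tendsto (fun τ => Real.exp (-a * τ) * g τ) atBot (𝓝 b) := by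
  obtain ⟨C, hC⟩ := F.linear_bound ha
  refine F.deriv_scaled.exists_tendsto (r := a / 3) (C := C) (by positivity) fun τ hτ => ?_
  rw [abs_mul, Real.abs_exp]
  calc Real.exp (-a * τ) * |h τ - a * g τ|
      ≤ Real.exp (-a * τ) * (C * Real.exp (4 * a / 3 * τ)) := by gcongr; exact hC τ hτ
    _ = _ := by
      rw [mul_left_comm, ← Real.exp_add]
      ring_nf

theorem tendsto_scaled_h (F : IsDecayingFlow c a T f g h) (ha : 0 < a)
    (hb : Tendsto (fun τ => Real.exp (-a * τ) * g τ) atBot (𝓝 b)) :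
    Tendsto (fun τ => Real.exp (-a * τ) * h τ) atBot (𝓝 (a * b)) := by
  obtain ⟨C, hC⟩ := F.linear_bound ha
  have h0 := tendsto_zero_of_exp_bound (ε := a) (by linarith) hC
  have := h0.add (hb.const_mul a)
  rw [zero_add] at this
  exact this.congr fun τ => by ring

theorem tendsto_ratio (F : IsDecayingFlow c a T f g h) (ha : 0 < a)
    (hb : Tendsto (fun τ => Real.exp (-a * τ) * g τ) atBot (𝓝 b)) (hb0 : b ≠ 0) :
    Tendsto (fun τ => h τ / g τ) atBot (𝓝 a) := by
  have := (F.tendsto_scaled_h ha hb).div hb hb0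
  rw [mul_div_cancel_right₀ _ hb0] at this
  exact this.congr fun τ => mul_div_mul_left _ _ (Real.exp_pos _).ne'

/-- The linear weight τ - s costs a factor exp(a(τ - s)/3), which lowers the rate from 4a/3 to a. -/
theorem sub_mul_bound {τ C : ℝ} {x : ℝ → ℝ} (ha : 0 < a)
    (hx : ∀ s ≤ τ, |x s| ≤ C * Real.exp (4 * a / 3 * s)) :
    ∀ s ≤ τ, |(τ - s) * x s| ≤ 3 / a * Real.exp (a / 3 * τ) * C * Real.exp (a * s) := by
  intro s hs
  have h1 : a / 3 * (τ - s) ≤ Real.exp (a / 3 * (τ - s)) := by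
    have := Real.add_one_le_exp (a / 3 * (τ - s)); linarith
  have h2 : τ - s ≤ 3 / a * Real.exp (a / 3 * (τ - s)) := by
    calc τ - s = 3 / a * (a / 3 * (τ - s)) := by field_simp
      _ ≤ _ := by gcongr
  rw [abs_mul, abs_of_nonneg (sub_nonneg.2 hs)]
  calc (τ - s) * |x s| ≤ (3 / a * Real.exp (a / 3 * (τ - s))) * (C * Real.exp (4 * a / 3 * s)) := by
        gcongr
        exact hx s hs
    _ = 3 / a * C * Real.exp (a / 3 * (τ - s) + 4 * a / 3 * s) := by rw [Real.exp_add]; ring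
    _ = 3 / a * C * Real.exp (a / 3 * τ + a * s) := by ring_nf
    _ = _ := by rw [Real.exp_add]; ring

theorem integral_flux (F : IsDecayingFlow c a T f g h) (ha : 0 < a) {τ : ℝ} (hτ : τ ≤ T) :
    IntegrableOn (fun t => g t ^ 2) (Iic τ) ∧
      h τ + f τ * g τ = c * ∫ t in Iic τ, g t ^ 2 := by
  have F' := F.mono hτ
  obtain ⟨C, hC, H⟩ := F'.sq_bound ha
  have hi : IntegrableOn (fun t => g t ^ 2) (Iic τ) :=
    integrableOn_Iic_of_exp_bound (r := 4 * a / 3) (by positivity)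
      (F'.deriv_g.continuousOn.pow 2) H
  refine ⟨hi, ?_⟩
  have := integral_Iic_of_hasDerivAt_of_tendsto
    (F'.deriv_flux.continuousOn τ self_mem_Iic)
    (fun s hs => F'.deriv_flux.hasDerivAt hs) (hi.const_mul c) (F'.tendsto_flux ha)
  rw [sub_zero, integral_const_mul] at this
  exact this.symm

theorem flux_nonneg (F : IsDecayingFlow c a T f g h) (ha : 0 < a) (hc : 0 ≤ c) {τ : ℝ}
    (hτ : τ ≤ T) : 0 ≤ h τ + f τ * g τ :=
  F.deriv_flux.nonneg_of_tendsto_zero (fun τ _ => by positivity) (F.tendsto_flux ha) hτ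

theorem deriv_energy (F : IsDecayingFlow c a T f g h) :
    HasDerivIic T (fun τ => g τ - (a ^ 2 - f τ ^ 2) / 2) (fun τ => h τ + f τ * g τ) := by
  intro τ hτ
  refine ((F.deriv_g τ hτ).sub ((((F.deriv_f τ hτ).pow 2).const_sub (a ^ 2)).div_const 2)).congr_deriv ?_
  simp
  ring

theorem tendsto_energy (F : IsDecayingFlow c a T f g h) (ha : 0 < a) :
    Tendsto (fun τ => g τ - (a ^ 2 - f τ ^ 2) / 2) atBot (𝓝 0) := by
  have := (F.tendsto_g ha).sub ((((F.tendsto_f' ha).pow 2).const_sub (a ^ 2)).div_const 2)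
  rwa [show (0 - (a ^ 2 - (-a) ^ 2) / 2 : ℝ) = 0 by ring] at this

theorem energy_nonneg (F : IsDecayingFlow c a T f g h) (ha : 0 < a) (hc : 0 ≤ c) {τ : ℝ}
    (hτ : τ ≤ T) : (a ^ 2 - f τ ^ 2) / 2 ≤ g τ :=
  sub_nonneg.1 <| F.deriv_energy.nonneg_of_tendsto_zero (fun _ h => F.flux_nonneg ha hc h.le)
    (F.tendsto_energy ha) hτ

theorem integral_energy (F : IsDecayingFlow c a T f g h) (ha : 0 < a) {τ : ℝ} (hτ : τ ≤ T) :
    IntegrableOn (fun s => (τ - s) * g s ^ 2) (Iic τ) ∧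
      g τ = (a ^ 2 - f τ ^ 2) / 2 + c * ∫ s in Iic τ, (τ - s) * g s ^ 2 := by
  have F' := F.mono hτ
  obtain ⟨C, hC, H⟩ := F'.sq_bound ha
  obtain ⟨B, hB⟩ := F'.flux_bound ha
  have hi : IntegrableOn (fun s => (τ - s) * g s ^ 2) (Iic τ) :=
    integrableOn_Iic_of_exp_bound ha
      ((by fun_prop : Continuous fun s : ℝ => τ - s).continuousOn.mul
        (F'.deriv_g.continuousOn.pow 2)) (sub_mul_bound ha H)
  refine ⟨hi, ?_⟩
  -- Adding (τ - s) times the flux performs the integration by parts: the flux terms cancel in the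
  -- derivative, so one integral suffices instead of a double one.
  have hd : HasDerivIic τ
      (fun s => (g s - (a ^ 2 - f s ^ 2) / 2) + (τ - s) * (h s + f s * g s))
      (fun s => c * ((τ - s) * g s ^ 2)) := by
    intro s hs
    refine ((F'.deriv_energy s hs).add ((((hasDerivAt_id s).const_sub τ).hasDerivWithinAt).mul
      (F'.deriv_flux s hs))).congr_deriv ?_
    simp
    ring
  have hlim := (F'.tendsto_energy ha).add
    (tendsto_zero_of_exp_bound' ha (sub_mul_bound ha hB))
  rw [add_zero] at hlim
  have := integral_Iic_of_hasDerivAt_of_tendsto (hd.continuousOn τ self_mem_Iic)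
    (fun s hs => hd.hasDerivAt hs) (hi.const_mul c) hlim
  rw [integral_const_mul] at this
  rw [this]
  ring

/-- Nonnegative flux says g' ≥ -f g with -f → a, so the sign of b propagates from -∞. -/
theorem g_pos (F : IsDecayingFlow c a T f g h) (ha : 0 < a) (hc : 0 ≤ c)
    (hb : Tendsto (fun τ => Real.exp (-a * τ) * g τ) atBot (𝓝 b)) (hb0 : 0 < b) :
    ∀ τ ≤ T, 0 < g τ := by
  obtain ⟨C, hC, H⟩ := F.bound (ε := 2 * a / 3) (by positivity) (by linarith)
  refine (F.deriv_g.comparison (α := fun τ => -f τ) (C := C) (r := 2 * a / 3) (by positivity)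
    F.deriv_f.continuousOn.neg (fun τ hτ => ?_) (fun τ hτ => ?_) hb).2 hb0
  · rw [show -f τ - a = -(f τ + a) by ring, abs_neg]
    exact (H τ hτ).1
  · have := F.flux_nonneg ha hc hτ.le
    linarith

theorem h_nonneg (F : IsDecayingFlow c a T f g h) (ha : 0 < a) (hc : 0 ≤ c)
    (hg : ∀ τ ≤ T, 0 < g τ) {τ : ℝ} (hτ : τ ≤ T) (hf : f τ ≤ 0) : 0 ≤ h τ := by
  have := F.flux_nonneg ha hc hτ
  have := mul_nonneg (neg_nonneg.2 hf) (hg τ hτ).le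
  linarith

/-! ### Log-concavity of f' and the sign of b. -/

/-- `f''' f' - f''^2`, the numerator of the derivative of `f'' / f'`. -/
def logConcavity (c : ℝ) (f g h : ℝ → ℝ) (τ : ℝ) : ℝ :=
  (-f τ * h τ + (c - 1) * g τ ^ 2) * g τ - h τ ^ 2

theorem deriv_logConcavity (F : IsDecayingFlow c a T f g h) :
    HasDerivIic T (logConcavity c f g h)
      (fun τ => -f τ * logConcavity c f g h τ - (2 - c) * g τ ^ 2 * h τ) := by
  intro τ hτ
  have hf := F.deriv_f τ hτ
  have hg := F.deriv_g τ hτ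
  have hh := F.deriv_h τ hτ
  refine ((((hf.neg.mul hh).add ((hg.pow 2).const_mul (c - 1))).mul hg).sub
    (hh.pow 2)).congr_deriv ?_
  simp [logConcavity]
  ring

theorem tendsto_logConcavity (F : IsDecayingFlow c a T f g h) (ha : 0 < a)
    (hb : Tendsto (fun τ => Real.exp (-a * τ) * g τ) atBot (𝓝 b)) :
    Tendsto (fun τ => Real.exp (-a * τ) * logConcavity c f g h τ) atBot (𝓝 0) := by
  have h1 := (((F.tendsto_f' ha).neg.mul (F.tendsto_h ha)).add
    (((F.tendsto_g ha).pow 2).const_mul (c - 1))).mul hb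
  have h2 := (F.tendsto_h ha).mul (F.tendsto_scaled_h ha hb)
  have := h1.sub h2
  simp only [mul_zero, zero_mul, ne_eq, OfNat.ofNat_ne_zero, not_false_eq_true, zero_pow,
    add_zero, sub_zero] at this
  refine this.congr fun τ => ?_
  simp only [logConcavity]
  ring

theorem deriv_ratio (F : IsDecayingFlow c a T f g h) (hg : ∀ τ ≤ T, g τ ≠ 0) :
    HasDerivIic T (fun τ => h τ / g τ) (fun τ => logConcavity c f g h τ / g τ ^ 2) := by
  intro τ hτ
  refine ((F.deriv_h τ hτ).div (F.deriv_g τ hτ) (hg τ hτ)).congr_deriv ?_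
  simp only [logConcavity]
  ring

/-- Since c ≤ 2, the forcing term -(2-c) g² h in the linear equation for W has the sign opposite to
h. As exp(-aτ) W → 0, the comparison principle transfers that sign to W. -/
theorem logConcavity_sign (F : IsDecayingFlow c a T f g h) (ha : 0 < a) (hc : c ≤ 2)
    (hb : Tendsto (fun τ => Real.exp (-a * τ) * g τ) atBot (𝓝 b)) :
    ((∀ τ < T, 0 ≤ h τ) → ∀ τ ≤ T, logConcavity c f g h τ ≤ 0) ∧
    ((∀ τ < T, h τ ≤ 0) → ∀ τ ≤ T, 0 ≤ logConcavity c f g h τ) := by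
  obtain ⟨C, hC, H⟩ := F.bound (ε := 2 * a / 3) (by positivity) (by linarith)
  have hα : ∀ τ ≤ T, |-f τ - a| ≤ C * Real.exp (2 * a / 3 * τ) := fun τ hτ => by
    rw [show -f τ - a = -(f τ + a) by ring, abs_neg]
    exact (H τ hτ).1
  have hW := F.tendsto_logConcavity ha hb
  have hc' : 0 ≤ 2 - c := by linarith
  constructor
  · intro hh τ hτ
    have hd : HasDerivIic T (fun τ => -logConcavity c f g h τ) _ :=
      fun τ hτ => (F.deriv_logConcavity τ hτ).neg
    have := (hd.comparison (α := fun τ => -f τ) (L := 0) (by positivity)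
      F.deriv_f.continuousOn.neg hα (fun τ hτ => ?_) ?_).1 le_rfl τ hτ
    · linarith
    · have := mul_nonneg (mul_nonneg hc' (sq_nonneg (g τ))) (hh τ hτ)
      linarith
    · simpa using hW.neg
  · intro hh
    refine (F.deriv_logConcavity.comparison (α := fun τ => -f τ) (by positivity)
      F.deriv_f.continuousOn.neg hα (fun τ hτ => ?_) hW).1 le_rfl
    have := mul_nonneg (mul_nonneg hc' (sq_nonneg (g τ))) (neg_nonneg.2 (hh τ hτ))
    linarith

/-- Where h ≥ 0 the quotient h/g is nonincreasing, and it starts from the limit a at -∞. -/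
theorem h_le (F : IsDecayingFlow c a T f g h) (ha : 0 < a) (hc : c ≤ 2)
    (hb : Tendsto (fun τ => Real.exp (-a * τ) * g τ) atBot (𝓝 b)) (hb0 : 0 < b)
    (hg : ∀ τ ≤ T, 0 < g τ) (hh : ∀ τ < T, 0 ≤ h τ) {τ : ℝ} (hτ : τ ≤ T) : h τ ≤ a * g τ := by
  have hanti := (F.deriv_ratio fun τ hτ => (hg τ hτ).ne').antitoneOn fun τ hτ =>
    div_nonpos_of_nonpos_of_nonneg ((F.logConcavity_sign ha hc hb).1 hh τ hτ.le) (sq_nonneg _)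
  have := le_of_monotoneOn_of_tendsto (T := T) (fun u hu v hv huv => neg_le_neg (hanti hu hv huv))
    (F.tendsto_ratio ha hb hb0.ne').neg hτ
  exact (div_le_iff₀ (hg τ hτ)).1 (neg_le_neg_iff.1 this)

theorem g_le (F : IsDecayingFlow c a T f g h) (ha : 0 < a)
    (hh : ∀ τ ≤ T, h τ ≤ a * g τ) {τ : ℝ} (hτ : τ ≤ T) : g τ ≤ a * (f τ + a) := by
  have hd : HasDerivIic T (fun τ => a * (f τ + a) - g τ) (fun τ => a * g τ - h τ) :=
    fun τ hτ => (((F.deriv_f τ hτ).add_const a).const_mul a).sub (F.deriv_g τ hτ)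
  refine sub_nonneg.1 (hd.nonneg_of_tendsto_zero (fun τ hτ => sub_nonneg.2 (hh τ hτ.le)) ?_ hτ)
  simpa using ((F.tendsto_f ha).const_mul a).sub (F.tendsto_g ha)

/-- Here g < 0 and h/g is nondecreasing from the limit a, so h ≤ a g < 0 persists at the endpoint: h
cannot have a first zero. -/
theorem h_neg_of_forall_lt (F : IsDecayingFlow c a T f g h) (ha : 0 < a) (hc : c ≤ 2)
    (hb : Tendsto (fun τ => Real.exp (-a * τ) * g τ) atBot (𝓝 b)) (hb0 : b < 0)
    (hh : ∀ τ < T, h τ < 0) : h T < 0 := by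
  have hd : HasDerivIic T (fun τ => -g τ) (fun τ => -h τ) := fun τ hτ => (F.deriv_g τ hτ).neg
  have hg : ∀ τ ≤ T, g τ < 0 := fun τ hτ => by
    have h1 := hd.strictMonoOn (fun τ hτ => neg_pos.2 (hh τ hτ))
      (a := τ - 1) (b := τ) (by simp only [mem_Iic]; linarith) hτ (by linarith)
    have h2 := hd.nonneg_of_tendsto_zero (fun τ hτ => (neg_pos.2 (hh τ hτ)).le)
      (by simpa using (F.tendsto_g ha).neg) (show τ - 1 ≤ T by linarith)
    simp only at h1 h2
    linarith
  have hmono := (F.deriv_ratio fun τ hτ => (hg τ hτ).ne).monotoneOn fun τ hτ =>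
    div_nonneg ((F.logConcavity_sign ha hc hb).2 (fun τ hτ => (hh τ hτ).le) τ hτ.le) (sq_nonneg _)
  have := le_of_monotoneOn_of_tendsto hmono (F.tendsto_ratio ha hb hb0.ne) le_rfl
  have h3 := (le_div_iff_of_neg (hg T le_rfl)).1 this
  have h4 := mul_neg_of_pos_of_neg ha (hg T le_rfl)
  linarith

theorem h_neg (F : IsDecayingFlow c a T f g h) (ha : 0 < a) (hc : c ≤ 2)
    (hb : Tendsto (fun τ => Real.exp (-a * τ) * g τ) atBot (𝓝 b)) (hb0 : b < 0) :
    ∀ τ ≤ T, h τ < 0 := by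
  by_contra! hcon
  obtain ⟨τ₁, hτ₁, hpos⟩ := hcon
  have hev := (F.tendsto_scaled_h ha hb).eventually (gt_mem_nhds (mul_neg_of_pos_of_neg ha hb0))
  obtain ⟨S, hS⟩ := eventually_atBot.1 hev
  have hS' : ∀ τ ≤ S, h τ < 0 := fun τ hτ => by
    by_contra! hn
    exact absurd (hS τ hτ) (not_lt.2 (mul_nonneg (Real.exp_pos _).le hn))
  have hcl : IsClosed {t ∈ Icc S T | 0 ≤ h t} :=
    (F.deriv_h.continuousOn.mono Icc_subset_Iic_self).preimage_isClosed_of_isClosed isClosed_Icc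
      isClosed_Ici
  have hne : {t ∈ Icc S T | 0 ≤ h t}.Nonempty := by
    refine ⟨τ₁, ⟨?_, hτ₁⟩, hpos⟩
    by_contra! hlt
    linarith [hS' τ₁ hlt.le]
  have hbd : BddBelow {t ∈ Icc S T | 0 ≤ h t} := ⟨S, fun t ht => ht.1.1⟩
  have hmem := hcl.csInf_mem hne hbd
  -- The first point after S where h ≥ 0; the endpoint lemma applied on (-∞, t] excludes it.
  set t := sInf {t ∈ Icc S T | 0 ≤ h t}
  refine absurd hmem.2 (not_le.2 ?_)
  refine (F.mono hmem.1.2).h_neg_of_forall_lt ha hc hb hb0 fun τ hτ => ?_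
  by_contra! hge
  rcases le_total τ S with hle | hle
  · linarith [hS' τ hle]
  · exact absurd (csInf_le hbd ⟨⟨hle, hτ.le.trans hmem.1.2⟩, hge⟩) (not_le.2 hτ)

theorem f_le_neg (F : IsDecayingFlow c a T f g h) (ha : 0 < a) (hc : c ≤ 2)
    (hb : Tendsto (fun τ => Real.exp (-a * τ) * g τ) atBot (𝓝 b)) (hb0 : b < 0) {τ : ℝ}
    (hτ : τ ≤ T) : f τ ≤ -a := by
  have hh := F.h_neg ha hc hb hb0
  have hd : HasDerivIic T (fun τ => -g τ) (fun τ => -h τ) := fun τ hτ => (F.deriv_g τ hτ).neg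
  have hg : ∀ τ ≤ T, 0 ≤ -g τ := fun τ hτ =>
    hd.nonneg_of_tendsto_zero (fun τ hτ => (neg_pos.2 (hh τ hτ.le)).le)
      (by simpa using (F.tendsto_g ha).neg) hτ
  have hd' : HasDerivIic T (fun τ => -(f τ + a)) (fun τ => -g τ) :=
    fun τ hτ => ((F.deriv_f τ hτ).add_const a).neg
  have := hd'.nonneg_of_tendsto_zero (fun τ hτ => hg τ hτ.le)
    (by simpa using (F.tendsto_f ha).neg) hτ
  linarith

theorem le_tanh (F : IsDecayingFlow c a 0 f g h) (ha : 0 < a) (hc : 0 ≤ c)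
    (hf : ∀ τ ≤ 0, f τ ≤ 0) (hf0 : f 0 = 0) {τ : ℝ} (hτ : τ ≤ 0) :
    f τ ≤ a * Real.tanh (a * τ / 2) := by
  have hpos : ∀ τ ≤ 0, 0 < a - f τ := fun τ hτ => by linarith [hf τ hτ]
  -- This expression is a first integral of f' = (a² - f²)/2. Since the flow satisfies g ≥ (a² -
  -- f²)/2, it is nondecreasing along the flow, with value 1 at τ = 0.
  have hd : HasDerivIic 0 (fun τ => Real.exp (-a * τ) * ((a + f τ) / (a - f τ)))
      (fun τ => Real.exp (-a * τ) * (2 * a / (a - f τ) ^ 2) * (g τ - (a ^ 2 - f τ ^ 2) / 2)) := by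
    intro τ hτ
    refine ((hasDerivAt_exp_mul (-a) τ).hasDerivWithinAt.mul
      (((F.deriv_f τ hτ).const_add a).div ((F.deriv_f τ hτ).const_sub a)
        (hpos τ hτ).ne')).congr_deriv ?_
    have := (hpos τ hτ).ne'
    simp only [Pi.div_apply]
    field_simp
    ring
  have hmono := hd.monotoneOn fun τ hτ => mul_nonneg (by positivity)
    (sub_nonneg.2 (F.energy_nonneg ha hc hτ.le))
  have h1 := hmono hτ self_mem_Iic hτ
  simp only [hf0, mul_zero, Real.exp_zero, add_zero, sub_zero, div_self ha.ne', one_mul] at h1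
  rw [← mul_div_assoc, div_le_one (hpos τ hτ)] at h1
  have e1 : Real.exp (-a * τ) = (Real.exp (-(a * τ / 2))) ^ 2 := by
    rw [← Real.exp_nat_mul]
    congr 1
    push_cast
    ring
  have e2 : Real.exp (-(a * τ / 2)) * Real.exp (a * τ / 2) = 1 := by
    rw [← Real.exp_add]
    simp
  rw [Real.tanh_eq_sinh_div_cosh, Real.sinh_eq, Real.cosh_eq, div_div_div_cancel_right₀ two_ne_zero,
    ← mul_div_assoc, le_div_iff₀ (by positivity)]
  rw [e1] at h1
  have h2 := mul_le_mul_of_nonneg_left h1 (Real.exp_pos (a * τ / 2)).le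
  have h3 : Real.exp (a * τ / 2) * (Real.exp (-(a * τ / 2)) ^ 2 * (a + f τ)) =
      Real.exp (-(a * τ / 2)) * (a + f τ) := by
    linear_combination (Real.exp (-(a * τ / 2)) * (a + f τ)) * e2
  linarith

theorem exp_le (F : IsDecayingFlow c a 0 f g h) (hg : ∀ τ ≤ 0, g τ ≤ a * (f τ + a))
    (hf0 : f 0 = 0) {τ : ℝ} (hτ : τ ≤ 0) : a * (Real.exp (a * τ) - 1) ≤ f τ := by
  have hd : HasDerivIic 0 (fun τ => Real.exp (-a * τ) * (f τ + a))
      (fun τ => Real.exp (-a * τ) * (g τ - a * (f τ + a))) := by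
    intro τ hτ
    refine ((hasDerivAt_exp_mul (-a) τ).hasDerivWithinAt.mul
      ((F.deriv_f τ hτ).add_const a)).congr_deriv ?_
    ring
  have h1 := (hd.antitoneOn fun τ hτ => mul_nonpos_of_nonneg_of_nonpos (Real.exp_pos _).le
    (sub_nonpos.2 (hg τ hτ.le))) hτ self_mem_Iic hτ
  simp only [hf0, mul_zero, Real.exp_zero, zero_add, one_mul] at h1
  have h2 := mul_le_mul_of_nonneg_left h1 (Real.exp_pos (a * τ)).le
  rw [← mul_assoc, ← Real.exp_add, show a * τ + -a * τ = 0 by ring, Real.exp_zero] at h2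
  linarith

end IsDecayingFlow

/-! ### Uniqueness of decaying flows. -/

/-- The vector field of `f''' + f f'' = (c - 1) f'^2` on the phase space of `(f, f', f'')`. -/
def phaseField (c : ℝ) (X : ℝ × ℝ × ℝ) : ℝ × ℝ × ℝ :=
  (X.2.1, X.2.2, -X.1 * X.2.2 + (c - 1) * X.2.1 ^ 2)

theorem exists_lipschitzOnWith_phaseField (c R : ℝ) :
    ∃ K, LipschitzOnWith K (phaseField c) (Metric.closedBall 0 R) := by
  have : ContDiff ℝ 1 (phaseField c) := by
    unfold phaseField
    fun_prop
  exact this.contDiffOn.exists_lipschitzOnWith one_ne_zero (convex_closedBall 0 R)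
    (isCompact_closedBall 0 R)

namespace IsDecayingFlow

variable {c a T b S : ℝ} {f g h f₁ g₁ h₁ f₂ g₂ h₂ : ℝ → ℝ}

theorem continuousOn_phase (F : IsDecayingFlow c a T f g h) :
    ContinuousOn (fun τ => (f τ, g τ, h τ)) (Iic T) :=
  F.deriv_f.continuousOn.prodMk (F.deriv_g.continuousOn.prodMk F.deriv_h.continuousOn)

theorem hasDerivAt_phase (F : IsDecayingFlow c a T f g h) {τ : ℝ} (hτ : τ < T) :
    HasDerivAt (fun τ => (f τ, g τ, h τ)) (phaseField c (f τ, g τ, h τ)) τ :=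
  (F.deriv_f.hasDerivAt hτ).prodMk ((F.deriv_g.hasDerivAt hτ).prodMk (F.deriv_h.hasDerivAt hτ))

theorem eq_of_eq_at (F₁ : IsDecayingFlow c a T f₁ g₁ h₁) (F₂ : IsDecayingFlow c a T f₂ g₂ h₂)
    (hS : (f₁ S, g₁ S, h₁ S) = (f₂ S, g₂ S, h₂ S)) {τ : ℝ} (hSτ : S ≤ τ) (hτ : τ ≤ T) :
    f₁ τ = f₂ τ := by
  have hc₁ := F₁.continuousOn_phase.mono (Icc_subset_Iic_self : Icc S T ⊆ Iic T)
  have hc₂ := F₂.continuousOn_phase.mono (Icc_subset_Iic_self : Icc S T ⊆ Iic T)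
  obtain ⟨R₁, hR₁⟩ := isCompact_Icc.exists_bound_of_continuousOn hc₁
  obtain ⟨R₂, hR₂⟩ := isCompact_Icc.exists_bound_of_continuousOn hc₂
  obtain ⟨K, hK⟩ := exists_lipschitzOnWith_phaseField c (max R₁ R₂)
  have := ODE_solution_unique_of_mem_Icc_right (v := fun _ => phaseField c)
    (s := fun _ => Metric.closedBall 0 (max R₁ R₂)) (fun _ _ => hK) hc₁
    (fun t ht => (F₁.hasDerivAt_phase ht.2).hasDerivWithinAt)
    (fun t ht => mem_closedBall_zero_iff.2 ((hR₁ t (Ico_subset_Icc_self ht)).trans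
      (le_max_left _ _))) hc₂
    (fun t ht => (F₂.hasDerivAt_phase ht.2).hasDerivWithinAt)
    (fun t ht => mem_closedBall_zero_iff.2 ((hR₂ t (Ico_subset_Icc_self ht)).trans
      (le_max_right _ _))) hS
  exact congrArg Prod.fst (this ⟨hSτ, hτ⟩)

/-- The contraction estimate behind uniqueness near `-∞`. -/
theorem contraction (F₁ : IsDecayingFlow c a T f₁ g₁ h₁) (F₂ : IsDecayingFlow c a T f₂ g₂ h₂)
    (ha : 0 < a) {C M : ℝ}
    (hb₁ : Tendsto (fun τ => Real.exp (-a * τ) * g₁ τ) atBot (𝓝 b))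
    (hb₂ : Tendsto (fun τ => Real.exp (-a * τ) * g₂ τ) atBot (𝓝 b))
    (hC₁ : ∀ τ ≤ T, |g₁ τ| ≤ C * Real.exp (a * τ))
    (hC₂ : ∀ τ ≤ T, |g₂ τ| ≤ C * Real.exp (a * τ))
    (hM : ∀ τ ≤ T, |g₁ τ - g₂ τ| ≤ M * Real.exp (a * τ)) {τ : ℝ} (hτ : τ ≤ T) :
    |g₁ τ - g₂ τ| ≤ ((|c| + 2) * C / a ^ 2 * Real.exp (a * T)) * M * Real.exp (a * τ) := by
  have hC : 0 ≤ C := nonneg_of_mul_nonneg_left ((abs_nonneg _).trans (hC₁ T le_rfl))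
    (Real.exp_pos _)
  have hM0 : 0 ≤ M := nonneg_of_mul_nonneg_left ((abs_nonneg _).trans (hM T le_rfl))
    (Real.exp_pos _)
  have hsq : ∀ τ, Real.exp (a * τ) * Real.exp (a * τ) = Real.exp (2 * a * τ) := fun τ => by
    rw [← Real.exp_add]
    ring_nf
  have hΔf : ∀ τ ≤ T, |f₁ τ - f₂ τ| ≤ M / a * Real.exp (a * τ) := fun τ hτ => by
    have hd : HasDerivIic T (fun τ => f₁ τ - f₂ τ) (fun τ => g₁ τ - g₂ τ) :=
      fun τ hτ => (F₁.deriv_f τ hτ).sub (F₂.deriv_f τ hτ)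
    have := hd.exp_bound ha hM (L := 0)
      (by simpa using (F₁.tendsto_f' ha).sub (F₂.tendsto_f' ha)) hτ
    simpa using this
  have hf₂ : ∀ τ ≤ T, |f₂ τ + a| ≤ C / a * Real.exp (a * τ) := fun τ hτ => by
    have := F₂.deriv_f.exp_bound ha hC₂ (F₂.tendsto_f' ha) hτ
    simpa using this
  have hΔK : ∀ τ ≤ T, |(h₁ τ + f₁ τ * g₁ τ) - (h₂ τ + f₂ τ * g₂ τ)| ≤
      |c| * (M * (2 * C)) / (2 * a) * Real.exp (2 * a * τ) := fun τ hτ => by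
    have hd : HasDerivIic T (fun τ => (h₁ τ + f₁ τ * g₁ τ) - (h₂ τ + f₂ τ * g₂ τ))
        (fun τ => c * g₁ τ ^ 2 - c * g₂ τ ^ 2) :=
      fun τ hτ => (F₁.deriv_flux τ hτ).sub (F₂.deriv_flux τ hτ)
    have := hd.exp_bound (L := 0) (r := 2 * a) (C := |c| * (M * (2 * C))) (by positivity)
      (fun τ hτ => ?_) (by simpa using (F₁.tendsto_flux ha).sub (F₂.tendsto_flux ha)) hτ
    · simpa using this
    · have h1 : |g₁ τ + g₂ τ| ≤ 2 * C * Real.exp (a * τ) :=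
        (abs_add_le _ _).trans (by linarith [hC₁ τ hτ, hC₂ τ hτ])
      calc |c * g₁ τ ^ 2 - c * g₂ τ ^ 2| = |c| * (|g₁ τ - g₂ τ| * |g₁ τ + g₂ τ|) := by
            rw [← abs_mul, ← abs_mul]
            ring_nf
        _ ≤ |c| * ((M * Real.exp (a * τ)) * (2 * C * Real.exp (a * τ))) := by
            gcongr
            exact hM τ hτ
        _ = _ := by rw [← hsq]; ring
  -- Equal limits b make this difference tend to 0, so its derivative can be integrated from -∞. The
  -- quadratic bounds leave a spare factor exp(aτ) ≤ exp(aT), which becomes the contraction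
  -- constant.
  have hd : HasDerivIic T (fun τ => Real.exp (-a * τ) * g₁ τ - Real.exp (-a * τ) * g₂ τ)
      (fun τ => Real.exp (-a * τ) * (h₁ τ - a * g₁ τ) - Real.exp (-a * τ) * (h₂ τ - a * g₂ τ)) :=
    fun τ hτ => (F₁.deriv_scaled τ hτ).sub (F₂.deriv_scaled τ hτ)
  have hp := hd.exp_bound (L := 0) (C := (|c| + 2) * C / a * M) ha (fun τ hτ => ?_)
    (by simpa using hb₁.sub hb₂) hτ
  · rw [sub_zero, ← mul_sub, abs_mul, Real.abs_exp] at hp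
    calc |g₁ τ - g₂ τ| = Real.exp (a * τ) * (Real.exp (-a * τ) * |g₁ τ - g₂ τ|) := by
          rw [← mul_assoc, ← Real.exp_add]
          simp
      _ ≤ Real.exp (a * τ) * ((|c| + 2) * C / a * M / a * Real.exp (a * τ)) := by gcongr
      _ ≤ Real.exp (a * τ) * ((|c| + 2) * C / a * M / a * Real.exp (a * T)) := by gcongr
      _ = _ := by field_simp
  · have e : Real.exp (-a * τ) * (h₁ τ - a * g₁ τ) - Real.exp (-a * τ) * (h₂ τ - a * g₂ τ) =
        Real.exp (-a * τ) * (((h₁ τ + f₁ τ * g₁ τ) - (h₂ τ + f₂ τ * g₂ τ)) -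
          ((f₁ τ - f₂ τ) * g₁ τ + (f₂ τ + a) * (g₁ τ - g₂ τ))) := by ring
    have e2 : |(f₁ τ - f₂ τ) * g₁ τ| ≤ M / a * C * Real.exp (2 * a * τ) := by
      rw [abs_mul]
      calc _ ≤ (M / a * Real.exp (a * τ)) * (C * Real.exp (a * τ)) := by
            gcongr
            exacts [hΔf τ hτ, hC₁ τ hτ]
        _ = _ := by rw [← hsq]; ring
    have e3 : |(f₂ τ + a) * (g₁ τ - g₂ τ)| ≤ C / a * M * Real.exp (2 * a * τ) := by
      rw [abs_mul]
      calc _ ≤ (C / a * Real.exp (a * τ)) * (M * Real.exp (a * τ)) := by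
            gcongr
            exacts [hf₂ τ hτ, hM τ hτ]
        _ = _ := by rw [← hsq]; ring
    rw [e, abs_mul, Real.abs_exp]
    calc _ ≤ Real.exp (-a * τ) * (|c| * (M * (2 * C)) / (2 * a) * Real.exp (2 * a * τ) +
            (M / a * C * Real.exp (2 * a * τ) + C / a * M * Real.exp (2 * a * τ))) := by
          gcongr
          exact (abs_sub _ _).trans (add_le_add (hΔK τ hτ)
            ((abs_add_le _ _).trans (add_le_add e2 e3)))
      _ = (|c| + 2) * C / a * M * (Real.exp (-a * τ) * Real.exp (2 * a * τ)) := by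
          field_simp
          ring
      _ = _ := by
          rw [← Real.exp_add]
          ring_nf

theorem exists_eq_near_atBot (F₁ : IsDecayingFlow c a T f₁ g₁ h₁)
    (F₂ : IsDecayingFlow c a T f₂ g₂ h₂) (ha : 0 < a)
    (hb₁ : Tendsto (fun τ => Real.exp (-a * τ) * g₁ τ) atBot (𝓝 b))
    (hb₂ : Tendsto (fun τ => Real.exp (-a * τ) * g₂ τ) atBot (𝓝 b)) :
    ∃ S ≤ T, ∀ τ ≤ S, (f₁ τ, g₁ τ, h₁ τ) = (f₂ τ, g₂ τ, h₂ τ) := by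
  obtain ⟨C₁, hC₁, H₁⟩ := exists_exp_bound F₁.deriv_g.continuousOn hb₁
  obtain ⟨C₂, hC₂, H₂⟩ := exists_exp_bound F₂.deriv_g.continuousOn hb₂
  set C := max C₁ C₂
  have H₁' : ∀ τ ≤ T, |g₁ τ| ≤ C * Real.exp (a * τ) := fun τ hτ =>
    (H₁ τ hτ).trans (by gcongr; exact le_max_left _ _)
  have H₂' : ∀ τ ≤ T, |g₂ τ| ≤ C * Real.exp (a * τ) := fun τ hτ =>
    (H₂ τ hτ).trans (by gcongr; exact le_max_right _ _)
  have hlim : Tendsto (fun S => (|c| + 2) * C / a ^ 2 * Real.exp (a * S)) atBot (𝓝 0) := by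
    simpa using (tendsto_exp_mul_atBot ha).const_mul ((|c| + 2) * C / a ^ 2)
  -- S is taken far enough left that the contraction constant is at most 1/2; iterating then gives
  -- g₁ = g₂.
  obtain ⟨S, hS, hST⟩ := ((hlim.eventually (eventually_le_nhds (by norm_num : (0 : ℝ) < 1 / 2))).and
    (eventually_le_atBot T)).exists
  have hn : ∀ n : ℕ, ∀ τ ≤ S, |g₁ τ - g₂ τ| ≤ ((1 / 2) ^ n * (2 * C)) * Real.exp (a * τ) := by
    intro n
    induction n with
    | zero =>
      intro τ hτ
      have := (abs_sub (g₁ τ) (g₂ τ)).trans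
        (add_le_add (H₁' τ (hτ.trans hST)) (H₂' τ (hτ.trans hST)))
      linarith
    | succ n ih =>
      intro τ hτ
      refine ((F₁.mono hST).contraction (F₂.mono hST) ha hb₁ hb₂
        (fun τ hτ => H₁' τ (hτ.trans hST)) (fun τ hτ => H₂' τ (hτ.trans hST)) ih hτ).trans ?_
      rw [pow_succ' (1 / 2 : ℝ), mul_assoc (1 / 2 : ℝ)]
      have : 0 < C := lt_max_of_lt_left hC₁
      gcongr
  have hg : ∀ τ ≤ S, g₁ τ = g₂ τ := fun τ hτ => by
    have hlim : Tendsto (fun n : ℕ => ((1 / 2 : ℝ) ^ n * (2 * C)) * Real.exp (a * τ)) atTop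
        (𝓝 0) := by
      simpa using ((tendsto_pow_atTop_nhds_zero_of_lt_one (r := (1 / 2 : ℝ)) (by norm_num)
        (by norm_num)).mul_const (2 * C)).mul_const (Real.exp (a * τ))
    have := ge_of_tendsto' hlim fun n => hn n τ hτ
    exact sub_eq_zero.1 (abs_nonpos_iff.1 this)
  have hf : ∀ τ ≤ S, f₁ τ = f₂ τ := fun τ hτ => by
    have hd : HasDerivIic S (fun τ => f₁ τ - f₂ τ) (fun τ => g₁ τ - g₂ τ) :=
      fun τ hτ => ((F₁.mono hST).deriv_f τ hτ).sub ((F₂.mono hST).deriv_f τ hτ)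
    have := hd.exp_bound (C := 0) (L := 0) ha (fun τ hτ => by simp [hg τ hτ])
      (by simpa using (F₁.tendsto_f' ha).sub (F₂.tendsto_f' ha)) hτ
    rw [sub_zero, zero_div, zero_mul] at this
    exact sub_eq_zero.1 (abs_nonpos_iff.1 this)
  have hh : ∀ τ ≤ S, h₁ τ = h₂ τ := fun τ hτ => by
    have e₁ := (F₁.mono hST).deriv_g τ hτ
    have e₂ := ((F₂.mono hST).deriv_g τ hτ).congr (fun t ht => hg t ht) (hg τ hτ)
    exact (uniqueDiffOn_Iic S τ hτ).eq_deriv _ e₁ e₂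
  exact ⟨S, hST, fun τ hτ => by rw [hf τ hτ, hg τ hτ, hh τ hτ]⟩

theorem eqOn_of_scaled (F₁ : IsDecayingFlow c a T f₁ g₁ h₁)
    (F₂ : IsDecayingFlow c a T f₂ g₂ h₂) (ha : 0 < a)
    (hb₁ : Tendsto (fun τ => Real.exp (-a * τ) * g₁ τ) atBot (𝓝 b))
    (hb₂ : Tendsto (fun τ => Real.exp (-a * τ) * g₂ τ) atBot (𝓝 b)) : EqOn f₁ f₂ (Iic T) := by
  obtain ⟨S, hST, hS⟩ := F₁.exists_eq_near_atBot F₂ ha hb₁ hb₂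
  intro τ hτ
  rcases le_total τ S with hle | hle
  · exact congrArg Prod.fst (hS τ hle)
  · exact F₁.eq_of_eq_at F₂ (hS S le_rfl) hle hτ

/-- Translating the second flow by s = log(b₁/b₂)/a matches the limits. The ordering b₁ ≤ b₂ makes s
≤ 0, so the translate is still defined on (-∞, 0]. -/
theorem eqOn_of_scaled_le {b₁ b₂ : ℝ} (F₁ : IsDecayingFlow c a 0 f₁ g₁ h₁)
    (F₂ : IsDecayingFlow c a 0 f₂ g₂ h₂) (ha : 0 < a) (hc : 0 ≤ c)
    (hb₁ : Tendsto (fun τ => Real.exp (-a * τ) * g₁ τ) atBot (𝓝 b₁))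
    (hb₂ : Tendsto (fun τ => Real.exp (-a * τ) * g₂ τ) atBot (𝓝 b₂))
    (h0 : 0 < b₁) (hle : b₁ ≤ b₂) (hf₁ : f₁ 0 = 0) (hf₂ : f₂ 0 = 0) : EqOn f₁ f₂ (Iic 0) := by
  have h2 : 0 < b₂ := h0.trans_le hle
  set s := Real.log (b₁ / b₂) / a with hs
  have hs0 : s ≤ 0 := div_nonpos_of_nonpos_of_nonneg
    (Real.log_nonpos (by positivity) ((div_le_one h2).2 hle)) ha.le
  have hG := (F₂.comp_add s).mono (S := 0) (by linarith)
  have hGb := tendsto_exp_mul_comp_add hb₂ s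
  rw [hs, mul_div_cancel₀ _ ha.ne', Real.exp_log (by positivity), div_mul_cancel₀ _ h2.ne',
    ← hs] at hGb
  have heq := F₁.eqOn_of_scaled hG ha hb₁ hGb
  have hmono := F₂.deriv_f.strictMonoOn fun τ hτ => F₂.g_pos ha hc hb₂ h2 τ hτ.le
  have e0 := heq (self_mem_Iic (a := (0 : ℝ)))
  simp only [zero_add] at e0
  -- The second flow vanishes at both s and 0, and it is strictly increasing.
  have hs1 : s = 0 := hmono.injOn (mem_Iic.2 hs0) self_mem_Iic (by rw [← e0, hf₁, hf₂])
  intro τ hτ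
  have := heq hτ
  simp only at this
  rw [this, hs1, add_zero]

/-- A decaying flow that vanishes at `0` starts in the increasing direction. -/
theorem scaled_pos (F : IsDecayingFlow c a 0 f g h) (ha : 0 < a) (hc : c ≤ 2)
    (hb : Tendsto (fun τ => Real.exp (-a * τ) * g τ) atBot (𝓝 b)) (hf0 : f 0 = 0) : 0 < b := by
  rcases lt_trichotomy b 0 with hneg | rfl | hpos
  · have := F.f_le_neg ha hc hb hneg le_rfl
    linarith
  · have F₀ : IsDecayingFlow c a 0 (fun _ => -a) (fun _ => 0) (fun _ => 0) := by
      refine ⟨fun τ _ => hasDerivWithinAt_const .., fun τ _ => hasDerivWithinAt_const ..,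
        fun τ _ => ?_, ?_, ?_, ?_⟩
      · simpa using hasDerivWithinAt_const (c := (0 : ℝ)) τ (Iic (0 : ℝ))
      all_goals simp
    have := F.eqOn_of_scaled F₀ ha hb (by simp) self_mem_Iic
    simp only at this
    linarith
  · exact hpos

theorem eqOn_of_zero (F₁ : IsDecayingFlow c a 0 f₁ g₁ h₁) (F₂ : IsDecayingFlow c a 0 f₂ g₂ h₂)
    (ha : 0 < a) (hc : 0 ≤ c) (hc2 : c ≤ 2) (hf₁ : f₁ 0 = 0) (hf₂ : f₂ 0 = 0) :
    EqOn f₁ f₂ (Iic 0) := by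
  obtain ⟨b₁, hb₁⟩ := F₁.exists_tendsto_scaled ha
  obtain ⟨b₂, hb₂⟩ := F₂.exists_tendsto_scaled ha
  rcases le_total b₁ b₂ with h | h
  · exact F₁.eqOn_of_scaled_le F₂ ha hc hb₁ hb₂ (F₁.scaled_pos ha hc2 hb₁ hf₁) h hf₁ hf₂
  · exact (F₂.eqOn_of_scaled_le F₁ ha hc hb₂ hb₁ (F₂.scaled_pos ha hc2 hb₂ hf₂) h hf₂ hf₁).symm

end IsDecayingFlow

/-! ### The Lyapunov series. -/

theorem lyapunovCoeff_zero (m a : ℝ) : lyapunovCoeff m a 0 = 0 := by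
  rw [lyapunovCoeff]

/-- For m ≥ 1/2 one has |(m-1)/m| ≤ 1, so each of the l - 1 summands has weight at most l². This
cancels the l²(l-1) in the denominator and the geometric bound reproduces itself. -/
theorem abs_lyapunovCoeff_le {m a : ℝ} (hm : 1 / 2 ≤ m) (ha : 0 < a) (n : ℕ) :
    |lyapunovCoeff m a n| ≤ a * a⁻¹ ^ n := by
  have hm0 : 0 < m := by linarith
  have hκ : |(m - 1) / m| ≤ 1 := by
    rw [abs_div, abs_of_pos hm0, div_le_one hm0, abs_le]
    constructor <;> linarith
  induction n using Nat.strong_induction_on with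
  | _ l ih =>
    rcases lt_or_ge l 2 with hl | hl
    · interval_cases l
      · simpa [lyapunovCoeff_zero] using ha.le
      · simp [lyapunovCoeff_one, ha.ne']
    · have hl' : (2 : ℝ) ≤ l := by exact_mod_cast hl
      have hden : 0 < a * (l : ℝ) ^ 2 * ((l : ℝ) - 1) :=
        mul_pos (by positivity) (by linarith)
      rw [lyapunovCoeff_rec m a l hl, abs_div, abs_of_pos hden, div_le_iff₀ hden]
      have hterm : ∀ k ∈ Finset.Icc 1 (l - 1),
          |(k : ℝ) * ((m - 1) * ((l : ℝ) - (k : ℝ)) / m - (k : ℝ))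
            * lyapunovCoeff m a k * lyapunovCoeff m a (l - k)| ≤
          (l : ℝ) * l * (a * a * a⁻¹ ^ l) := by
        intro k hk
        obtain ⟨hk1, hk2⟩ := Finset.mem_Icc.1 hk
        have hkl : k < l := by omega
        have hkl' : (k : ℝ) ≤ l := by exact_mod_cast hkl.le
        have h1 : |(m - 1) * ((l : ℝ) - k) / m - k| ≤ l := by
          have e : (m - 1) * ((l : ℝ) - k) / m = (m - 1) / m * (l - k) := by ring
          have h2 : |(m - 1) / m * ((l : ℝ) - k)| ≤ 1 * (l - k) := by
            rw [abs_mul, abs_of_nonneg (sub_nonneg.2 hkl')]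
            gcongr
          rw [e]
          refine (abs_sub _ _).trans ?_
          rw [Nat.abs_cast]
          linarith
        rw [abs_mul, abs_mul, abs_mul, Nat.abs_cast]
        calc _ ≤ (l : ℝ) * l * (a * a⁻¹ ^ k) * (a * a⁻¹ ^ (l - k)) := by
              gcongr
              exacts [ih k hkl, ih (l - k) (by omega)]
          _ = (l : ℝ) * l * (a * a * (a⁻¹ ^ k * a⁻¹ ^ (l - k))) := by ring
          _ = _ := by rw [← pow_add, Nat.add_sub_cancel' hkl.le]
      refine (Finset.abs_sum_le_sum_abs _ _).trans ((Finset.sum_le_sum hterm).trans_eq ?_)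
      rw [Finset.sum_const, Nat.card_Icc, nsmul_eq_mul, Nat.add_sub_cancel, Nat.cast_pred (by omega)]
      ring

/-- The recursion with denominators cleared, in Cauchy product form. The value h₀ = 0 removes the
two extra end terms, and both sides vanish for n = 0 and n = 1. -/
theorem sum_antidiagonal_lyapunovCoeff {m a : ℝ} (ha : 0 < a) (n : ℕ) :
    ∑ p ∈ Finset.HasAntidiagonal.antidiagonal n, (p.1 : ℝ) * ((m - 1) / m * p.2 - p.1) *
      lyapunovCoeff m a p.1 * lyapunovCoeff m a p.2 =
      a * n ^ 2 * (n - 1) * lyapunovCoeff m a n := by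
  rw [Finset.Nat.sum_antidiagonal_eq_sum_range_succ_mk]
  rcases lt_or_ge n 2 with hn | hn
  · interval_cases n <;> simp [Finset.sum_range_succ, lyapunovCoeff_zero]
  · have hn' : (2 : ℝ) ≤ n := by exact_mod_cast hn
    have hden : a * (n : ℝ) ^ 2 * ((n : ℝ) - 1) ≠ 0 :=
      (mul_pos (by positivity) (by linarith)).ne'
    rw [lyapunovCoeff_rec m a n hn, mul_div_cancel₀ _ hden]
    symm
    refine Finset.sum_subset_zero_on_sdiff (fun k hk => ?_) (fun k hk => ?_) (fun k hk => ?_)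
    · simp only [Finset.mem_Icc, Finset.mem_range] at *
      omega
    · have : k = 0 ∨ k = n := by
        simp only [Finset.mem_Icc, Finset.mem_range, Finset.mem_sdiff] at hk
        omega
      rcases this with rfl | rfl <;> simp [lyapunovCoeff_zero]
    · have hk' : k ≤ n := by
        simp only [Finset.mem_Icc] at hk
        omega
      simp only [Nat.cast_sub hk']
      ring

/-- The `n`-th term of the `j`-th derivative (up to `a ^ j`) of the Lyapunov series with parameter
`a / 2`. -/
def seriesTerm (m a : ℝ) (j n : ℕ) (τ : ℝ) : ℝ :=
  lyapunovCoeff m a n * n ^ j * (a / 2) ^ n * Real.exp (n * a * τ)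

/-- The `j`-th derivative (up to `a ^ j`) of the Lyapunov series with parameter `a / 2`. -/
def seriesSum (m a : ℝ) (j : ℕ) (τ : ℝ) : ℝ := ∑' n, seriesTerm m a j n τ

section Series

variable {m a : ℝ}

/-- The parameter a/2 against the bound a · a⁻ⁿ leaves the ratio 1/2 on all of τ ≤ 0. The factor
exp(aτ) survives because the term n = 0 vanishes. -/
theorem abs_seriesTerm_le (hm : 1 / 2 ≤ m) (ha : 0 < a) (j n : ℕ) {τ : ℝ} (hτ : τ ≤ 0) :
    |seriesTerm m a j n τ| ≤ a * (n ^ j * (1 / 2) ^ n) * Real.exp (a * τ) := by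
  rcases Nat.eq_zero_or_pos n with rfl | hn
  · simp [seriesTerm, lyapunovCoeff_zero]
    positivity
  · have hn' : (1 : ℝ) ≤ n := by exact_mod_cast hn
    rw [seriesTerm, abs_mul, abs_mul, abs_mul, Real.abs_exp, abs_of_nonneg (by positivity : (0 : ℝ) ≤ n ^ j),
      abs_of_nonneg (by positivity : 0 ≤ (a / 2) ^ n)]
    calc _ ≤ a * a⁻¹ ^ n * n ^ j * (a / 2) ^ n * Real.exp (a * τ) := by
          gcongr ?_ * _ * _ * Real.exp ?_
          · exact abs_lyapunovCoeff_le hm ha n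
          · have := mul_nonpos_of_nonneg_of_nonpos ha.le hτ
            nlinarith
      _ = a * (n ^ j * (a⁻¹ * (a / 2)) ^ n) * Real.exp (a * τ) := by rw [mul_pow]; ring
      _ = _ := by
          congr 4
          field_simp

theorem summable_seriesBound (a : ℝ) (j : ℕ) :
    Summable fun n : ℕ => a * ((n : ℝ) ^ j * (1 / 2) ^ n) :=
  (summable_pow_mul_geometric_of_norm_lt_one j (by norm_num)).mul_left a

theorem summable_norm_seriesTerm (hm : 1 / 2 ≤ m) (ha : 0 < a) (j : ℕ) {τ : ℝ} (hτ : τ ≤ 0) :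
    Summable fun n => ‖seriesTerm m a j n τ‖ :=
  Summable.of_nonneg_of_le (fun _ => norm_nonneg _) (fun n => abs_seriesTerm_le hm ha j n hτ)
    ((summable_seriesBound a j).mul_right (Real.exp (a * τ)))

theorem abs_seriesSum_le (hm : 1 / 2 ≤ m) (ha : 0 < a) (j : ℕ) {τ : ℝ} (hτ : τ ≤ 0) :
    |seriesSum m a j τ| ≤ (∑' n : ℕ, a * ((n : ℝ) ^ j * (1 / 2) ^ n)) * Real.exp (a * τ) := by
  rw [← tsum_mul_right]
  exact tsum_of_norm_bounded (f := fun n => seriesTerm m a j n τ) ((summable_seriesBound a j).mul_right (Real.exp (a * τ))).hasSum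
    fun n => abs_seriesTerm_le hm ha j n hτ

theorem hasDerivAt_seriesSum (hm : 1 / 2 ≤ m) (ha : 0 < a) (j : ℕ) {τ : ℝ} (hτ : τ < 0) :
    HasDerivAt (seriesSum m a j) (a * seriesSum m a (j + 1) τ) τ := by
  have := hasDerivAt_tsum_of_isPreconnected (t := Iio (0 : ℝ)) (y₀ := τ) (y := τ)
    (g := fun n τ => seriesTerm m a j n τ) (g' := fun n τ => a * seriesTerm m a (j + 1) n τ)
    ((summable_seriesBound a (j + 1)).mul_left a) isOpen_Iio isPreconnected_Iio
    (fun n τ _ => ?_) (fun n τ hτ => ?_) hτ (summable_norm_seriesTerm hm ha j hτ.le).of_norm hτ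
  · rw [tsum_mul_left] at this
    exact this
  · refine ((hasDerivAt_exp_mul (n * a) τ).const_mul _).congr_deriv ?_
    simp only [seriesTerm, pow_succ]
    ring
  · rw [norm_mul, Real.norm_of_nonneg ha.le]
    have h1 := abs_seriesTerm_le hm ha (j + 1) n (le_of_lt hτ)
    have h2 : Real.exp (a * τ) ≤ 1 :=
      Real.exp_le_one_iff.2 (mul_nonpos_of_nonneg_of_nonpos ha.le (le_of_lt hτ))
    have h3 : a * ((n : ℝ) ^ (j + 1) * (1 / 2) ^ n) * Real.exp (a * τ) ≤
        a * ((n : ℝ) ^ (j + 1) * (1 / 2) ^ n) := mul_le_of_le_one_right (by positivity) h2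
    exact mul_le_mul_of_nonneg_left (h1.trans h3) ha.le

/-- This is the equation for h' divided by a², with f = -a + S₀, g = a S₁, h = a² S₂; it holds
coefficientwise by the cleared recursion. -/
theorem seriesSum_ode (hm : 1 / 2 ≤ m) (ha : 0 < a) {τ : ℝ} (hτ : τ ≤ 0) :
    a * (seriesSum m a 3 τ - seriesSum m a 2 τ) =
      (m - 1) / m * seriesSum m a 1 τ ^ 2 - seriesSum m a 2 τ * seriesSum m a 0 τ := by
  have s := fun j => summable_norm_seriesTerm hm ha j hτ
  rw [pow_two, seriesSum, seriesSum, seriesSum, seriesSum,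
    tsum_mul_tsum_eq_tsum_sum_antidiagonal_of_summable_norm (s 1) (s 1),
    tsum_mul_tsum_eq_tsum_sum_antidiagonal_of_summable_norm (s 2) (s 0),
    ← tsum_mul_left, ← (s 3).of_norm.tsum_sub (s 2).of_norm, ← tsum_mul_left,
    ← ((summable_norm_sum_mul_antidiagonal_of_summable_norm (s 1) (s 1)).of_norm.mul_left
      _).tsum_sub (summable_norm_sum_mul_antidiagonal_of_summable_norm (s 2) (s 0)).of_norm]
  refine tsum_congr fun n => ?_
  have h := sum_antidiagonal_lyapunovCoeff (m := m) ha n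
  rw [Finset.mul_sum, ← Finset.sum_sub_distrib]
  calc _ = (a * n ^ 2 * (n - 1) * lyapunovCoeff m a n) * ((a / 2) ^ n * Real.exp (n * a * τ)) := by
        simp only [seriesTerm]
        ring
    _ = _ := by
        rw [← h, Finset.sum_mul]
        refine Finset.sum_congr rfl fun p hp => ?_
        obtain rfl := Finset.HasAntidiagonal.mem_antidiagonal.1 hp
        have e : Real.exp (((p.1 + p.2 : ℕ) : ℝ) * a * τ) =
            Real.exp (p.1 * a * τ) * Real.exp (p.2 * a * τ) := by
          rw [← Real.exp_add]
          push_cast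
          ring_nf
        simp only [seriesTerm]
        rw [e, pow_add]
        ring

theorem tendsto_scaled_seriesSum (hm : 1 / 2 ≤ m) (ha : 0 < a) :
    Tendsto (fun τ => Real.exp (-a * τ) * seriesSum m a 1 τ) atBot (𝓝 (a / 2)) := by
  have key : Tendsto (fun τ => ∑' n, Real.exp (-a * τ) * seriesTerm m a 1 n τ) atBot
      (𝓝 (∑' n : ℕ, if n = 1 then a / 2 else 0)) := by
    refine tendsto_tsum_of_dominated_convergence (summable_seriesBound a 1) (fun n => ?_) ?_
    · have e : ∀ τ, Real.exp (-a * τ) * seriesTerm m a 1 n τ =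
          lyapunovCoeff m a n * n * (a / 2) ^ n * Real.exp ((n - 1) * a * τ) := fun τ => by
        rw [seriesTerm, mul_left_comm, ← Real.exp_add]
        ring_nf
      simp only [e]
      rcases lt_trichotomy n 1 with hn | rfl | hn
      · obtain rfl : n = 0 := by omega
        simp
      · simp [lyapunovCoeff_one]
      · have hn' : (1 : ℝ) < n := by exact_mod_cast hn
        rw [if_neg (by omega)]
        simpa using (tendsto_exp_mul_atBot (mul_pos (sub_pos.2 hn') ha)).const_mul
          (lyapunovCoeff m a n * n * (a / 2) ^ n)
    · filter_upwards [eventually_le_atBot 0] with τ hτ n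
      rw [norm_mul, Real.norm_eq_abs, Real.abs_exp]
      calc _ ≤ Real.exp (-a * τ) * (a * ((n : ℝ) ^ 1 * (1 / 2) ^ n) * Real.exp (a * τ)) := by
            gcongr
            exact abs_seriesTerm_le hm ha 1 n hτ
        _ = _ := by
            rw [mul_left_comm, ← Real.exp_add]
            simp
  rw [tsum_ite_eq] at key
  simpa only [tsum_mul_left, seriesSum] using key

theorem hasSum_lyapunov (hm : 1 / 2 ≤ m) (ha : 0 < a) {τ : ℝ} (hτ : τ ≤ 0) :
    HasSum (fun n : ℕ => lyapunovCoeff m a (n + 2) * (a / 2) ^ (n + 2) *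
      Real.exp (((n : ℝ) + 2) * a * τ)) (seriesSum m a 0 τ - a / 2 * Real.exp (a * τ)) := by
  have h := (hasSum_nat_add_iff' 2).2 (summable_norm_seriesTerm hm ha 0 hτ).of_norm.hasSum
  have e1 : ∑' n, seriesTerm m a 0 n τ - ∑ i ∈ Finset.range 2, seriesTerm m a 0 i τ =
      seriesSum m a 0 τ - a / 2 * Real.exp (a * τ) := by
    simp [Finset.sum_range_succ, seriesTerm, lyapunovCoeff_zero, lyapunovCoeff_one, seriesSum]
  rw [e1] at h
  refine h.congr_fun fun n => ?_
  simp [seriesTerm]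

/-- Termwise differentiation is available for τ < 0 only, so the closed half-line ends at -1. -/
theorem isDecayingFlow_series (hm : 1 / 2 ≤ m) (ha : 0 < a) : IsDecayingFlow ((2 * m - 1) / m) a (-1)
    (fun τ => -a + seriesSum m a 0 τ) (fun τ => a * seriesSum m a 1 τ)
    (fun τ => a * (a * seriesSum m a 2 τ)) := by
  have hm0 : m ≠ 0 := by linarith
  have hlim : ∀ j ε, ε < a → Tendsto (fun τ => Real.exp (-ε * τ) * seriesSum m a j τ) atBot (𝓝 0) :=
    fun j ε hε => tendsto_zero_of_exp_bound hε fun τ hτ => abs_seriesSum_le hm ha j hτ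
  refine ⟨fun τ hτ => ?_, fun τ hτ => ?_, fun τ hτ => ?_, fun ε _ hε => ?_, fun ε _ hε => ?_,
    fun ε _ hε => ?_⟩
  · exact ((hasDerivAt_seriesSum hm ha 0 (by linarith)).const_add (-a)).hasDerivWithinAt
  · exact ((hasDerivAt_seriesSum hm ha 1 (by linarith)).const_mul a).hasDerivWithinAt
  · refine (((hasDerivAt_seriesSum hm ha 2 (by linarith)).const_mul a).const_mul
      a).hasDerivWithinAt.congr_deriv ?_
    have h := seriesSum_ode hm ha (show τ ≤ 0 by linarith)
    have e : (2 * m - 1) / m - 1 = (m - 1) / m := by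
      field_simp
      ring
    rw [e]
    linear_combination a ^ 2 * h
  · simpa using hlim 0 ε hε
  · simpa [mul_left_comm] using (hlim 1 ε hε).const_mul a
  · simpa [mul_left_comm] using ((hlim 2 ε hε).const_mul a).const_mul a

end Series

/-! ### Continuation of a flow up to its first zero. -/

/-- Truncation of a real number to `[-B, B]`. -/
def clamp (B x : ℝ) : ℝ := max (-B) (min B x)

theorem clamp_of_abs_le {B x : ℝ} (h : |x| ≤ B) : clamp B x = x := by
  rw [abs_le] at h
  rw [clamp, min_eq_right h.2, max_eq_right h.1]

theorem abs_clamp_le {B : ℝ} (hB : 0 ≤ B) (x : ℝ) : |clamp B x| ≤ B :=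
  abs_le.2 ⟨le_max_left _ _, max_le (by linarith) (min_le_left _ _)⟩

theorem lipschitzWith_clamp (B : ℝ) : LipschitzWith 1 (clamp B) :=
  (LipschitzWith.id.const_min B).const_max (-B)

/-- Coordinatewise truncation of the phase space to the box `[-B, B]^3`. -/
def clampPhase (B : ℝ) (X : ℝ × ℝ × ℝ) : ℝ × ℝ × ℝ := (clamp B X.1, clamp B X.2.1, clamp B X.2.2)

theorem clampPhase_of_norm_le {B : ℝ} {X : ℝ × ℝ × ℝ} (h : ‖X‖ ≤ B) : clampPhase B X = X := by
  simp only [Prod.norm_def, sup_le_iff, Real.norm_eq_abs] at h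
  simp [clampPhase, clamp_of_abs_le, h.1, h.2.1, h.2.2]

theorem norm_clampPhase_le {B : ℝ} (hB : 0 ≤ B) (X : ℝ × ℝ × ℝ) : ‖clampPhase B X‖ ≤ B := by
  simp only [Prod.norm_def, sup_le_iff, Real.norm_eq_abs, clampPhase]
  exact ⟨abs_clamp_le hB _, abs_clamp_le hB _, abs_clamp_le hB _⟩

theorem exists_lipschitzWith_clampPhase (B : ℝ) : ∃ K, LipschitzWith K (clampPhase B) := by
  have h2 : LipschitzWith _ (fun X : ℝ × ℝ × ℝ => X.2) := LipschitzWith.prod_snd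
  exact ⟨_, ((lipschitzWith_clamp B).comp LipschitzWith.prod_fst).prodMk
    (((lipschitzWith_clamp B).comp (LipschitzWith.prod_fst.comp h2)).prodMk
      ((lipschitzWith_clamp B).comp (LipschitzWith.prod_snd.comp h2)))⟩

/-- A bounded Lipschitz vector field has solutions on every compact interval. -/
theorem exists_solution_of_bounded_lipschitz {E : Type*} [NormedAddCommGroup E] [NormedSpace ℝ E]
    [CompleteSpace E] {v : E → E} {K : NNReal} {L : ℝ} (hK : LipschitzWith K v)
    (hL : ∀ x, ‖v x‖ ≤ L) {S T : ℝ} (hST : S ≤ T) (x₀ : E) :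
    ∃ α : ℝ → E, α S = x₀ ∧ ∀ t ∈ Icc S T, HasDerivWithinAt α (v (α t)) (Icc S T) t := by
  have hL0 : 0 ≤ L := (norm_nonneg _).trans (hL x₀)
  -- A solution of speed at most L stays in the ball of radius L(T - S), so the interval need not be
  -- short.
  have hPL : IsPicardLindelof (fun _ => v) (tmin := S) (tmax := T) ⟨S, left_mem_Icc.2 hST⟩ x₀
      (L.toNNReal * (T - S).toNNReal) 0 L.toNNReal K := by
    refine ⟨fun t _ => hK.lipschitzOnWith, fun x _ => continuousOn_const, fun t _ x _ => ?_, ?_⟩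
    · rw [Real.coe_toNNReal _ hL0]
      exact hL x
    · simp [hST]
  exact hPL.exists_eq_forall_mem_Icc_hasDerivWithinAt₀

theorem HasDerivIic.glue {S T : ℝ} {x x' y y' : ℝ → ℝ} (hST : S ≤ T) (hx : HasDerivIic S x x')
    (hy : ∀ τ ∈ Icc S T, HasDerivWithinAt y (y' τ) (Icc S T) τ) (h0 : x S = y S)
    (h1 : x' S = y' S) :
    HasDerivIic T (fun τ => if τ ≤ S then x τ else y τ)
      (fun τ => if τ ≤ S then x' τ else y' τ) := by
  intro τ hτ
  have hleft : ∀ t ∈ Iic S, (if t ≤ S then x t else y t) = x t := fun t ht => if_pos ht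
  have hright : ∀ t ∈ Icc S T, (if t ≤ S then x t else y t) = y t := fun t ht => by
    rcases ht.1.eq_or_lt with rfl | hlt
    · simp [h0]
    · simp [hlt]
  rcases lt_trichotomy τ S with hlt | rfl | hlt
  · simp only [if_pos hlt.le]
    have := ((hx τ hlt.le).congr hleft (hleft τ hlt.le)).hasDerivAt (Iic_mem_nhds hlt)
    exact this.hasDerivWithinAt
  · simp only [le_refl, if_true]
    have e1 := (hx τ le_rfl).congr hleft (hleft τ self_mem_Iic)
    have e2 := (hy τ ⟨le_rfl, hτ⟩).congr hright (hright τ ⟨le_rfl, hτ⟩)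
    rw [← h1] at e2
    have := e1.union e2
    rwa [Iic_union_Icc_eq_Iic hST] at this
  · simp only [if_neg (not_le.2 hlt)]
    refine ((hy τ ⟨hlt.le, hτ⟩).congr hright (hright τ ⟨hlt.le, hτ⟩)).mono_of_mem_nhdsWithin ?_
    rw [← Ici_inter_Iic]
    exact inter_mem (mem_nhdsWithin_of_mem_nhds (Ici_mem_nhds hlt)) self_mem_nhdsWithin

theorem IsDecayingFlow.congr {c a T S : ℝ} {f g h f₀ g₀ h₀ : ℝ → ℝ}
    (F : IsDecayingFlow c a S f₀ g₀ h₀) (hd : HasDerivIic T f g) (hd' : HasDerivIic T g h)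
    (hd'' : HasDerivIic T h (fun τ => -f τ * h τ + (c - 1) * g τ ^ 2))
    (hf : ∀ τ ≤ S, f₀ τ = f τ) (hg : ∀ τ ≤ S, g₀ τ = g τ) (hh : ∀ τ ≤ S, h₀ τ = h τ) :
    IsDecayingFlow c a T f g h := by
  refine ⟨hd, hd', hd'', fun ε h0 h1 => (F.lim_f ε h0 h1).congr' ?_,
    fun ε h0 h1 => (F.lim_g ε h0 h1).congr' ?_, fun ε h0 h1 => (F.lim_h ε h0 h1).congr' ?_⟩
  all_goals filter_upwards [eventually_le_atBot S] with τ hτ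
  · rw [hf τ hτ]
  · rw [hg τ hτ]
  · rw [hh τ hτ]

namespace IsDecayingFlow

variable {c a S b : ℝ} {f₀ g₀ h₀ : ℝ → ℝ}

/-- A priori bound: an increasing flow stays in a box as long as it is nonpositive. -/
theorem norm_lt {T : ℝ} {f g h : ℝ → ℝ} (F : IsDecayingFlow c a T f g h) (ha : 0 < a) (hc : 0 ≤ c)
    (hc2 : c ≤ 2) (hb : Tendsto (fun τ => Real.exp (-a * τ) * g τ) atBot (𝓝 b)) (hb0 : 0 < b)
    (hf : ∀ τ ≤ T, f τ ≤ 0) : ‖(f T, g T, h T)‖ < 1 + a + a ^ 2 + a ^ 3 := by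
  have hg := F.g_pos ha hc hb hb0
  have hh : ∀ τ ≤ T, 0 ≤ h τ := fun τ hτ => F.h_nonneg ha hc hg hτ (hf τ hτ)
  have hh' : ∀ τ ≤ T, h τ ≤ a * g τ := fun τ hτ =>
    F.h_le ha hc2 hb hb0 hg (fun τ hτ => hh τ hτ.le) hτ
  have hg' := F.g_le ha hh' le_rfl
  have e1 := hg T le_rfl
  have e2 := hh T le_rfl
  have e3 := hh' T le_rfl
  have e4 := hf T le_rfl
  have e5 : -a < f T := by
    have : 0 < a * (f T + a) := e1.trans_le hg'
    have := pos_of_mul_pos_right this ha.le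
    linarith
  have e6 : g T ≤ a ^ 2 := by nlinarith
  have e7 : h T ≤ a ^ 3 := by nlinarith
  have p2 : 0 < a ^ 2 := by positivity
  have p3 : 0 < a ^ 3 := by positivity
  simp only [Prod.norm_def, sup_lt_iff, Real.norm_eq_abs, abs_lt]
  refine ⟨⟨?_, ?_⟩, ⟨?_, ?_⟩, ⟨?_, ?_⟩⟩ <;> linarith

/-- The field truncated to the box has a solution on any compact interval. The strict a priori bound
`norm_lt` prevents leaving the box before f vanishes, so truncation is never active. -/
theorem exists_continuation (F₀ : IsDecayingFlow c a S f₀ g₀ h₀) (ha : 0 < a) (hc : 0 ≤ c)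
    (hc2 : c ≤ 2) (hb : Tendsto (fun τ => Real.exp (-a * τ) * g₀ τ) atBot (𝓝 b)) (hb0 : 0 < b)
    (hf₀ : ∀ τ ≤ S, f₀ τ < 0) :
    ∃ (T : ℝ) (f g h : ℝ → ℝ), IsDecayingFlow c a T f g h ∧ f T = 0 ∧
      ∀ τ ≤ S, f₀ τ = f τ ∧ g₀ τ = g τ := by
  set B := 1 + a + a ^ 2 + a ^ 3 with hB
  have hB0 : 0 ≤ B := by positivity
  have hg₀ := F₀.g_pos ha hc hb hb0
  have hbox : ‖(f₀ S, g₀ S, h₀ S)‖ < B := F₀.norm_lt ha hc hc2 hb hb0 fun τ hτ => (hf₀ τ hτ).le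
  -- The time at which the tangent line to f₀ at S reaches 0; a convex continuation must vanish by
  -- then.
  set T := S + (-f₀ S) / g₀ S with hT
  have hTS : S < T := by
    have : 0 < (-f₀ S) / g₀ S := div_pos (neg_pos.2 (hf₀ S le_rfl)) (hg₀ S le_rfl)
    linarith
  obtain ⟨K₁, hK₁⟩ := exists_lipschitzWith_clampPhase B
  obtain ⟨K₂, hK₂⟩ := exists_lipschitzOnWith_phaseField c B
  have hmaps : ∀ X, clampPhase B X ∈ Metric.closedBall (0 : ℝ × ℝ × ℝ) B := fun X =>
    mem_closedBall_zero_iff.2 (norm_clampPhase_le hB0 X)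
  have hlip : LipschitzWith (K₂ * K₁) (fun X => phaseField c (clampPhase B X)) := by
    rw [← lipschitzOnWith_univ]
    exact hK₂.comp hK₁.lipschitzOnWith fun X _ => hmaps X
  obtain ⟨L, hL⟩ := (isCompact_closedBall (0 : ℝ × ℝ × ℝ) B).exists_bound_of_continuousOn
    hK₂.continuousOn
  obtain ⟨α, hα0, hα⟩ := exists_solution_of_bounded_lipschitz hlip
    (fun X => hL _ (hmaps X)) hTS.le (f₀ S, g₀ S, h₀ S)
  have hclamp : clampPhase B (α S) = (f₀ S, g₀ S, h₀ S) := by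
    rw [hα0]
    exact clampPhase_of_norm_le hbox.le
  have hf := F₀.deriv_f.glue hTS.le (fun τ hτ => (hα τ hτ).fst) (by rw [hα0])
    (by rw [hclamp]; rfl)
  have hg := F₀.deriv_g.glue hTS.le (fun τ hτ => (hα τ hτ).snd.fst) (by rw [hα0])
    (by rw [hclamp]; rfl)
  have hh := F₀.deriv_h.glue hTS.le (fun τ hτ => (hα τ hτ).snd.snd) (by rw [hα0])
    (by rw [hclamp]; rfl)
  set f : ℝ → ℝ := fun τ => if τ ≤ S then f₀ τ else (α τ).1 with hfdef
  set g : ℝ → ℝ := fun τ => if τ ≤ S then g₀ τ else (α τ).2.1 with hgdef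
  set h : ℝ → ℝ := fun τ => if τ ≤ S then h₀ τ else (α τ).2.2 with hhdef
  have ef : ∀ τ ≤ S, f₀ τ = f τ := fun τ hτ => (if_pos hτ).symm
  have eg : ∀ τ ≤ S, g₀ τ = g τ := fun τ hτ => (if_pos hτ).symm
  have eh : ∀ τ ≤ S, h₀ τ = h τ := fun τ hτ => (if_pos hτ).symm
  have hbg : Tendsto (fun τ => Real.exp (-a * τ) * g τ) atBot (𝓝 b) := by
    refine hb.congr' ?_
    filter_upwards [eventually_le_atBot S] with τ hτ
    rw [eg τ hτ]
  -- Q ≤ 0 means that f is nonpositive and the state is in the box; while this holds, the truncated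
  -- solution solves the true system.
  set Q : ℝ → ℝ := fun τ => max (f τ) (‖(f τ, g τ, h τ)‖ - B) with hQ
  have hQc : ContinuousOn Q (Icc S T) := by
    refine ContinuousOn.mono ?_ (Icc_subset_Iic_self : Icc S T ⊆ Iic T)
    exact ContinuousOn.sup (f := f) hf.continuousOn (((hf.continuousOn.prodMk
      (hg.continuousOn.prodMk hh.continuousOn)).norm).sub continuousOn_const)
  have hQS : Q S < 0 := by
    simp only [hQ, ← ef S le_rfl, ← eg S le_rfl, ← eh S le_rfl]
    exact max_lt (hf₀ S le_rfl) (sub_neg.2 hbox)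
  have flow : ∀ t ≤ T, (∀ s ∈ Icc S t, Q s ≤ 0) → IsDecayingFlow c a t f g h := by
    intro t ht hs
    have key : ∀ s ≤ t, ¬ s ≤ S → clampPhase B (α s) = α s ∧ f s = (α s).1 ∧ g s = (α s).2.1 ∧
        h s = (α s).2.2 := fun s hst hsS => by
      have e1 : f s = (α s).1 := if_neg hsS
      have e2 : g s = (α s).2.1 := if_neg hsS
      have e3 : h s = (α s).2.2 := if_neg hsS
      refine ⟨clampPhase_of_norm_le ?_, e1, e2, e3⟩
      have := (le_max_right _ _).trans (hs s ⟨(not_le.1 hsS).le, hst⟩)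
      rw [e1, e2, e3] at this
      exact sub_nonpos.1 this
    refine F₀.congr (fun s hs => ?_) (fun s hs => ?_) (fun s hs => ?_) ef eg eh
    · refine ((hf.mono ht) s hs).congr_deriv ?_
      split_ifs with hsS
      · exact eg s hsS
      · obtain ⟨k0, k1, k2, k3⟩ := key s hs hsS
        rw [k0, k2]
        rfl
    · refine ((hg.mono ht) s hs).congr_deriv ?_
      split_ifs with hsS
      · exact eh s hsS
      · obtain ⟨k0, k1, k2, k3⟩ := key s hs hsS
        rw [k0, k3]
        rfl
    · refine ((hh.mono ht) s hs).congr_deriv ?_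
      split_ifs with hsS
      · rw [ef s hsS, eg s hsS, eh s hsS]
      · obtain ⟨k0, k1, k2, k3⟩ := key s hs hsS
        simp only [k0, k1, k2, k3]
        rfl
  have fneg : ∀ t, (∀ s ∈ Icc S t, Q s ≤ 0) → ∀ τ ≤ t, f τ ≤ 0 := by
    intro t hs τ hτ
    rcases le_total τ S with hle | hle
    · rw [← ef τ hle]
      exact (hf₀ τ hle).le
    · exact (le_max_left _ _).trans (hs τ ⟨hle, hτ⟩)
  have hcl : IsClosed {t ∈ Icc S T | 0 ≤ Q t} :=
    hQc.preimage_isClosed_of_isClosed isClosed_Icc isClosed_Ici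
  have hcl' : IsClosed {t ∈ Icc S T | Q t ≤ 0} :=
    hQc.preimage_isClosed_of_isClosed isClosed_Icc isClosed_Iic
  by_cases hne : {t ∈ Icc S T | 0 ≤ Q t}.Nonempty
  · have hbd : BddBelow {t ∈ Icc S T | 0 ≤ Q t} := ⟨S, fun t ht => ht.1.1⟩
    have hmem := hcl.csInf_mem hne hbd
    set t := sInf {t ∈ Icc S T | 0 ≤ Q t}
    have hSt : S < t := by
      refine hmem.1.1.lt_of_ne fun e => ?_
      have := hmem.2
      rw [← e] at this
      linarith
    have hsub : Ico S t ⊆ {t ∈ Icc S T | Q t ≤ 0} := fun s hs => by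
      have hsT : s ∈ Icc S T := ⟨hs.1, hs.2.le.trans hmem.1.2⟩
      refine ⟨hsT, ?_⟩
      by_contra! hpos
      exact absurd (csInf_le hbd ⟨hsT, hpos.le⟩) (not_le.2 hs.2)
    have hsub' := closure_minimal hsub hcl'
    rw [closure_Ico hSt.ne] at hsub'
    have hQt : ∀ s ∈ Icc S t, Q s ≤ 0 := fun s hs => (hsub' hs).2
    have F := flow t hmem.1.2 hQt
    refine ⟨t, f, g, h, F, ?_, fun τ hτ => ⟨ef τ hτ, eg τ hτ⟩⟩
    -- At the first time with Q ≥ 0 the norm is still strictly below B, so the maximum is attained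
    -- by f and f t = 0.
    have hlt := F.norm_lt ha hc hc2 hbg hb0 (fneg t hQt)
    have hft := fneg t hQt t le_rfl
    refine le_antisymm hft ?_
    rcases le_max_iff.1 hmem.2 with h0 | h0
    · exact h0
    · linarith
  · exfalso
    have hQ' : ∀ s ∈ Icc S T, Q s ≤ 0 := fun s hs => by
      by_contra! hpos
      exact hne ⟨s, hs, hpos.le⟩
    have F := flow T le_rfl hQ'
    have hgp := F.g_pos ha hc hbg hb0
    have hgm := F.deriv_g.monotoneOn fun τ hτ =>
      F.h_nonneg ha hc hgp hτ.le (fneg T hQ' τ hτ.le)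
    -- If Q never became nonnegative, g would be nondecreasing on [S, T], and the mean value theorem
    -- would give f T ≥ 0, hence Q T ≥ 0.
    obtain ⟨ξ, hξ, hslope⟩ := exists_hasDerivAt_eq_slope f g hTS
      (F.deriv_f.continuousOn.mono Icc_subset_Iic_self) fun s hs => F.deriv_f.hasDerivAt hs.2
    have h1 : g S ≤ g ξ := hgm hTS.le hξ.2.le hξ.1.le
    rw [hslope, le_div_iff₀ (sub_pos.2 hTS), ← eg S le_rfl, ← ef S le_rfl, hT, add_sub_cancel_left,
      mul_div_cancel₀ _ (hg₀ S le_rfl).ne', ← hT] at h1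
    exact hne ⟨T, ⟨hTS.le, le_rfl⟩, le_max_of_le_left (by linarith)⟩

end IsDecayingFlow

/-! ### Passage between boundary value solutions and flows; conclusion. -/

theorem HasDerivIic.eqOn_D {x x' : ℝ → ℝ} (hx : HasDerivIic 0 x x') : EqOn (D x) x' (Iic 0) :=
  fun τ hτ => (hx τ hτ).derivWithin (uniqueDiffOn_Iic 0 τ hτ)

theorem HasDerivIic.congr {T : ℝ} {x x' y y' : ℝ → ℝ} (hx : HasDerivIic T x x')
    (h : EqOn y x (Iic T)) (h' : EqOn y' x' (Iic T)) : HasDerivIic T y y' :=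
  fun τ hτ => ((hx τ hτ).congr h (h hτ)).congr_deriv (h' hτ).symm

theorem HasDerivIic.contDiffOn_succ {x x' : ℝ → ℝ} (hx : HasDerivIic 0 x x') {n : ℕ}
    (hx' : ContDiffOn ℝ n x' (Iic 0)) : ContDiffOn ℝ (n + 1) x (Iic 0) :=
  (contDiffOn_succ_iff_derivWithin (uniqueDiffOn_Iic 0)).2
    ⟨fun τ hτ => (hx τ hτ).differentiableWithinAt, by simp, hx'.congr hx.eqOn_D⟩

theorem hasDerivIic_D {n : ℕ} {x : ℝ → ℝ} (hx : ContDiffOn ℝ (n + 1) x (Iic 0)) :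
    HasDerivIic 0 x (D x) ∧ ContDiffOn ℝ n (D x) (Iic 0) := by
  obtain ⟨h1, -, h2⟩ := (contDiffOn_succ_iff_derivWithin (uniqueDiffOn_Iic 0)).1 hx
  exact ⟨fun τ hτ => (h1 τ hτ).hasDerivWithinAt, h2⟩

theorem IsBVPSolution.isDecayingFlow {m a : ℝ} {Ψ : ℝ → ℝ} (hΨ : IsBVPSolution m a Ψ) :
    IsDecayingFlow ((2 * m - 1) / m) a 0 Ψ (D Ψ) (D (D Ψ)) := by
  obtain ⟨h1, c1⟩ := hasDerivIic_D (n := 2) (x := Ψ) (by exact_mod_cast hΨ.smooth)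
  obtain ⟨h2, c2⟩ := hasDerivIic_D (n := 1) (x := D Ψ) (by exact_mod_cast c1)
  obtain ⟨h3, -⟩ := hasDerivIic_D (n := 0) (x := D (D Ψ)) (by exact_mod_cast c2)
  refine ⟨h1, h2, fun τ hτ => (h3 τ hτ).congr_deriv ?_, hΨ.lim_zero, hΨ.lim_one, hΨ.lim_two⟩
  have hd : HasDerivIic 0 (fun t => D (D Ψ) t + Ψ t * D Ψ t)
      (fun t => D (D (D Ψ)) t + (D Ψ t * D Ψ t + Ψ t * D (D Ψ) t)) :=
    fun τ hτ => (h3 τ hτ).add ((h1 τ hτ).mul (h2 τ hτ))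
  have := hΨ.ode τ hτ
  rw [hd.eqOn_D hτ] at this
  linear_combination this

namespace IsDecayingFlow

variable {c m a : ℝ} {f g h : ℝ → ℝ}

theorem eqOn_D_D (F : IsDecayingFlow c a 0 f g h) : EqOn (D (D f)) h (Iic 0) :=
  (F.deriv_g.congr F.deriv_f.eqOn_D (eqOn_refl h _)).eqOn_D

theorem isBVPSolution (F : IsDecayingFlow ((2 * m - 1) / m) a 0 f g h) (hf0 : f 0 = 0) :
    IsBVPSolution m a f where
  smooth := by
    have c0 : ContDiffOn ℝ (0 : ℕ) (fun τ => -f τ * h τ + ((2 * m - 1) / m - 1) * g τ ^ 2)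
        (Iic 0) := by
      rw [Nat.cast_zero, contDiffOn_zero]
      exact (F.deriv_f.continuousOn.neg.mul F.deriv_h.continuousOn).add
        (continuousOn_const.mul (F.deriv_g.continuousOn.pow 2))
    have c1 : ContDiffOn ℝ (1 : ℕ) h (Iic 0) := by exact_mod_cast F.deriv_h.contDiffOn_succ c0
    have c2 : ContDiffOn ℝ (2 : ℕ) g (Iic 0) := by exact_mod_cast F.deriv_g.contDiffOn_succ c1
    exact_mod_cast F.deriv_f.contDiffOn_succ c2
  ode τ hτ := by
    have hd := F.deriv_flux.congr (y := fun t => D (D f) t + f t * D f t)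
      (fun t ht => by simp only [F.eqOn_D_D ht, F.deriv_f.eqOn_D ht]) (eqOn_refl _ _)
    rw [hd.eqOn_D hτ, F.deriv_f.eqOn_D hτ]
  lim_zero := F.lim_f
  lim_one ε h0 h1 := by
    refine (F.lim_g ε h0 h1).congr' ?_
    filter_upwards [eventually_le_atBot 0] with τ hτ
    rw [F.deriv_f.eqOn_D hτ]
  lim_two ε h0 h1 := by
    refine (F.lim_h ε h0 h1).congr' ?_
    filter_upwards [eventually_le_atBot 0] with τ hτ
    rw [F.eqOn_D_D hτ]
  at_zero := hf0

end IsDecayingFlow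

theorem exists_flow_vanishing {m a : ℝ} (hm : 1 / 2 ≤ m) (ha : 0 < a) :
    ∃ f g h : ℝ → ℝ, IsDecayingFlow ((2 * m - 1) / m) a 0 f g h ∧ f 0 = 0 ∧
      ∃ d : ℝ, 0 < d ∧ IsLyapunovSeries m a d f := by
  have hm0 : 0 < m := by linarith
  have hc : 0 ≤ (2 * m - 1) / m := div_nonneg (by linarith) hm0.le
  have hc2 : (2 * m - 1) / m ≤ 2 := by
    rw [div_le_iff₀ hm0]
    linarith
  have F := isDecayingFlow_series hm ha
  have hb : Tendsto (fun τ => Real.exp (-a * τ) * (a * seriesSum m a 1 τ)) atBot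
      (𝓝 (a * (a / 2))) := by
    simpa [mul_left_comm] using (tendsto_scaled_seriesSum hm ha).const_mul a
  obtain ⟨S', hS'⟩ := eventually_atBot.1
    ((F.tendsto_f' ha).eventually (gt_mem_nhds (neg_lt_zero.2 ha)))
  set S := min S' (-1)
  have hS1 : S ≤ -1 := min_le_right _ _
  obtain ⟨T, f, g, h, G, hT, hG⟩ := (F.mono hS1).exists_continuation ha hc hc2 hb
    (by positivity) fun τ hτ => hS' τ (hτ.trans (min_le_left _ _))
  -- Moving the zero T to the origin turns the series parameter a/2 into (a/2) exp(aT). The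
  -- expansion holds where the continuation coincides with the series, that is for τ + T ≤ S.
  refine ⟨_, _, _, (G.comp_add T).mono (by linarith), by simpa using hT,
    a / 2 * Real.exp (a * T), by positivity, min (S - T) 0, min_le_right _ _, fun τ hτ => ?_⟩
  have hτS : τ + T ≤ S := by
    have := hτ.trans (min_le_left _ _)
    linarith
  have hs := hasSum_lyapunov hm ha (show τ + T ≤ 0 by linarith)
  have e : f (τ + T) - (-a + a / 2 * Real.exp (a * T) * Real.exp (a * τ)) =
      seriesSum m a 0 (τ + T) - a / 2 * Real.exp (a * (τ + T)) := by
    rw [← (hG _ hτS).1, mul_add, Real.exp_add]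
    ring
  rw [e]
  refine hs.congr_fun fun n => ?_
  rw [mul_pow, ← Real.exp_nat_mul, mul_add, Real.exp_add]
  push_cast
  rw [show ((n : ℝ) + 2) * a * T = ((n : ℝ) + 2) * (a * T) by ring]
  ring

end MixingLayer

end

theorem theorem1 (m a : ℝ) (hm : 1 / 2 ≤ m) (ha : 0 < a) :
    ∃ Φ : ℝ → ℝ,
      -- existence and uniqueness on the half-line
      MixingLayer.IsBVPSolution m a Φ ∧
      (∀ Ψ : ℝ → ℝ, MixingLayer.IsBVPSolution m a Ψ → EqOn Ψ Φ (Iic 0)) ∧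
      -- convex and strictly increasing
      ConvexOn ℝ (Iic 0) Φ ∧
      StrictMonoOn Φ (Iic 0) ∧
      -- a member of the Lyapunov family with positive parameter
      (∃ d : ℝ, 0 < d ∧ MixingLayer.IsLyapunovSeries m a d Φ) ∧
      -- the integral relations, with convergent integrals
      (∀ τ ≤ 0,
        IntegrableOn (fun t => (MixingLayer.D Φ t) ^ 2) (Iic τ) ∧
        MixingLayer.D (MixingLayer.D Φ) τ + Φ τ * MixingLayer.D Φ τ
          = ((2 * m - 1) / m) * ∫ t in Iic τ, (MixingLayer.D Φ t) ^ 2) ∧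
      (∀ τ ≤ 0,
        IntegrableOn (fun s => (τ - s) * (MixingLayer.D Φ s) ^ 2) (Iic τ) ∧
        MixingLayer.D Φ τ = (a ^ 2 - Φ τ ^ 2) / 2
          + ((2 * m - 1) / m) * ∫ s in Iic τ, (τ - s) * (MixingLayer.D Φ s) ^ 2) ∧
      MixingLayer.D (MixingLayer.D Φ) 0
          = ((2 * m - 1) / m) * ∫ t in Iic (0 : ℝ), (MixingLayer.D Φ t) ^ 2 ∧
      IntegrableOn (fun s => s * (MixingLayer.D Φ s) ^ 2) (Iic 0) ∧
      MixingLayer.D Φ 0 = a ^ 2 / 2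
          - ((2 * m - 1) / m) * ∫ s in Iic (0 : ℝ), s * (MixingLayer.D Φ s) ^ 2 ∧
      -- the two-sided estimate
      (∀ τ ≤ 0, a * (Real.exp (a * τ) - 1) ≤ Φ τ ∧ Φ τ ≤ a * Real.tanh (a * τ / 2)) := by
  have hm0 : 0 < m := by linarith
  have hc : 0 ≤ (2 * m - 1) / m := div_nonneg (by linarith) hm0.le
  have hc2 : (2 * m - 1) / m ≤ 2 := by
    rw [div_le_iff₀ hm0]
    linarith
  obtain ⟨f, g, h, F₀, hf0, hseries⟩ := MixingLayer.exists_flow_vanishing hm ha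
  have hsol := F₀.isBVPSolution hf0
  -- The flow is rebuilt with `D f` and `D (D f)` as components, the form used in the conclusions.
  have F := hsol.isDecayingFlow
  obtain ⟨b, hb⟩ := F.exists_tendsto_scaled ha
  have hb0 := F.scaled_pos ha hc2 hb hf0
  have hg := F.g_pos ha hc hb hb0
  have hmono := F.deriv_f.strictMonoOn fun τ hτ => hg τ hτ.le
  have hf : ∀ τ ≤ 0, f τ ≤ 0 := fun τ hτ => by
    rw [← hf0]
    exact hmono.monotoneOn hτ self_mem_Iic hτ
  have hh : ∀ τ ≤ 0, 0 ≤ MixingLayer.D (MixingLayer.D f) τ := fun τ hτ =>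
    F.h_nonneg ha hc hg hτ (hf τ hτ)
  have hle : ∀ τ ≤ 0, MixingLayer.D f τ ≤ a * (f τ + a) := fun τ hτ =>
    F.g_le ha (fun τ hτ => F.h_le ha hc2 hb hb0 hg (fun τ hτ => hh τ hτ.le) hτ) hτ
  have i1 := fun τ (hτ : τ ≤ 0) => F.integral_flux ha hτ
  have i2 := fun τ (hτ : τ ≤ 0) => F.integral_energy ha hτ
  have e0 : (fun s => s * MixingLayer.D f s ^ 2) =
      fun s => -((0 - s) * MixingLayer.D f s ^ 2) := by
    funext s
    ring
  refine ⟨f, hsol, fun Ψ hΨ => hΨ.isDecayingFlow.eqOn_of_zero F ha hc hc2 hΨ.at_zero hf0, ?_,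
    hmono, hseries, i1, i2, ?_, ?_, ?_, fun τ hτ => ⟨F.exp_le hle hf0 hτ, F.le_tanh ha hc hf hf0 hτ⟩⟩
  · refine convexOn_of_hasDerivWithinAt2_nonneg (f' := MixingLayer.D f)
      (f'' := MixingLayer.D (MixingLayer.D f)) (convex_Iic 0) F.deriv_f.continuousOn ?_ ?_ ?_
    all_goals
      intro τ hτ
      rw [interior_Iic] at hτ
    · exact (F.deriv_f.hasDerivAt hτ).hasDerivWithinAt
    · exact (F.deriv_g.hasDerivAt hτ).hasDerivWithinAt
    · exact hh τ (le_of_lt hτ)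
  · have := (i1 0 le_rfl).2
    rwa [hf0, zero_mul, add_zero] at this
  · rw [e0]
    exact (i2 0 le_rfl).1.neg
  · have := (i2 0 le_rfl).2
    rw [hf0] at this
    rw [e0, integral_neg, this]
    ring
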